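/- Let $p$ be a prime. A \emph{$T$-group} is a nontrivial pro-$p$ group $T$ which has a maximal closed subgroup $N$ (maximal among proper closed subgroups) that is abelian of exponent dividing $p$. For a $T$-group $T$ let $Z(T)$ be its center, $Z(T)[p]$ the subgroup of elements of $Z(T)$ of order dividing $p$, let $T_{(1)}=T$ and $T_{(n+1)}=\overline{[T_{(n)},T]}$ be its (closed) lower central series, and let $T^p$ be the closed subgroup generated by the $p$-th powers. Define the invariants \[ t_1=\dim_{\mathbb{F}_p}H^1\!\left(\frac{Z(T)[p]}{Z(T)\cap T_{(2)}},\mathbb{F}_p\right),\qquad t_i=\dim_{\mathbb{F}_p}H^1\!\left(\frac{Z(T)\cap T_{(i)}}{Z(T)\cap T_{(i+1)}},\mathbb{F}_p\right)\quad(2\le i\le p), \] \[ u=\max\{i:\ 1\le i\le p,\ T^p\subseteq T_{(i)}\}, \] where $H^1(A,\mathbb{F}_p)$ is the $\mathbb{F}_p$-vector space of continuous homomorphisms $A\to\mathbb{F}_p$ and the dimensions are (possibly infinite) cardinals. For arbitrary cardinals $t_1,\dots,t_p$ and an integer $u$ with $1\le u\le p$, the following are equivalent: (1) $t_1,\dots,t_p$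 and $u$ are the invariants of some $T$-group; (2) (a) if $u<p$ then $t_u\ge 1$, and (b) if $u=p$ and $t_i=0$ for all $2\le i\le p$, then $t_1\ge 1$. Moreover, $T$-groups are determined up to isomorphism by these invariants: if two $T$-groups (for the same $p$) have the same invariants $t_1,\dots,t_p$ and $u$, then they are isomorphic as topological groups. -/

import Mathlib

universe v

namespace TGroups

/-- A profinite group (compact, totally disconnected topological group) is pro-`p` if its quotient
by every open normal subgroup is a (necessarily finite) `p`-group. -/
def IsProP (p : ℕ) (T : ProfiniteGrp.{v}) : Prop :=
  ∀ U : OpenNormalSubgroup T, IsPGroup p (T ⧸ U.toSubgroup)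

/-- `N` is maximal among the proper closed subgroups of `T`. -/
def IsMaximalClosed {T : Type v} [Group T] [TopologicalSpace T] (N : Subgroup T) : Prop :=
  Maximal (fun H : Subgroup T => IsClosed (H : Set T) ∧ H ≠ ⊤) N

/-- A `T`-group: a nontrivial pro-`p` group with a maximal closed subgroup that is abelian of
exponent dividing `p`. -/
structure IsTGroup (p : ℕ) (T : ProfiniteGrp.{v}) : Prop where
  nontrivial : Nontrivial T
  proP : IsProP p T
  exists_maximal : ∃ N : Subgroup T, IsMaximalClosed N ∧
    (∀ a ∈ N, ∀ b ∈ N, a * b = b * a) ∧ ∀ a ∈ N, a ^ p = 1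

section Invariants

variable (p : ℕ) (T : Type v) [Group T] [TopologicalSpace T] [IsTopologicalGroup T]

/-- The (closed) lower central series `T_(n)`, indexed so that `T_(1) = T` and `T_(n+1)` is the
closed subgroup generated by the commutators of `T_(n)` with `T`. (The index `0` is not used.) -/
def centralSeries : ℕ → Subgroup T
  | 0 => ⊤
  | 1 => ⊤
  | n + 2 => (⁅centralSeries (n + 1), (⊤ : Subgroup T)⁆).topologicalClosure

/-- `T^p`: the closed subgroup generated by the `p`-th powers. -/
def powerSubgroup : Subgroup T :=
  (Subgroup.closure (Set.range fun x : T => x ^ p)).topologicalClosure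

/-- `Z(T)[p]`: the central elements of order dividing `p`. -/
def centerTorsion : Subgroup T where
  carrier := {z | z ∈ Subgroup.center T ∧ z ^ p = 1}
  one_mem' := ⟨Subgroup.one_mem _, one_pow p⟩
  mul_mem' := by
    rintro a b ⟨ha, ha'⟩ ⟨hb, hb'⟩
    refine ⟨Subgroup.mul_mem _ ha hb, ?_⟩
    have hab : Commute a b := (Subgroup.mem_center_iff.mp hb) a
    rw [hab.mul_pow, ha', hb', one_mul]
  inv_mem' := by
    rintro a ⟨ha, ha'⟩
    exact ⟨Subgroup.inv_mem _ ha, by rw [inv_pow, ha', inv_one]⟩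

instance center_inf_subgroupOf_normal {G : Type v} [Group G] (A K : Subgroup G) :
    ((Subgroup.center G ⊓ K).subgroupOf A).Normal where
  conj_mem := by
    rintro n hn g
    have hc : (n : G) ∈ Subgroup.center G := (Subgroup.mem_subgroupOf.mp hn).1
    have h : g * n * g⁻¹ = n := by
      apply Subtype.ext
      have := Subgroup.mem_center_iff.mp hc (g : G)
      simp [this]
    rwa [h]

/-- `H¹(A, 𝔽_p)` for the trivial action of the topological group `A` on the discrete group `𝔽_p`:
the `𝔽_p`-vector space of continuous homomorphisms `A → 𝔽_p` (these are the continuous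
1-cocycles, and the 1-coboundaries vanish). -/
def H1 (A : Type v) [Group A] [TopologicalSpace A] : Submodule (ZMod p) (A → ZMod p) where
  carrier := {f | Continuous f ∧ ∀ a b, f (a * b) = f a + f b}
  zero_mem' := ⟨continuous_const, by simp⟩
  add_mem' := by
    rintro f g ⟨hf, hf'⟩ ⟨hg, hg'⟩
    refine ⟨hf.add hg, fun a b => ?_⟩
    simp only [Pi.add_apply, hf', hg']
    abel
  smul_mem' := by
    rintro c f ⟨hf, hf'⟩
    refine ⟨continuous_const.mul hf, fun a b => ?_⟩
    simp only [Pi.smul_apply, hf', smul_add]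

/-- `dim H¹(A / (A ∩ Z(T) ∩ K), 𝔽_p)`, where the quotient carries the quotient topology. -/
noncomputable def dimH1 (A K : Subgroup T) : Cardinal.{v} :=
  Module.rank (ZMod p) (H1 p (A ⧸ (Subgroup.center T ⊓ K).subgroupOf A))

/-- The invariants `t_i`, `1 ≤ i ≤ p`:
`t_1 = dim H¹(Z(T)[p] / (Z(T) ∩ T_(2)), 𝔽_p)`, and
`t_i = dim H¹((Z(T) ∩ T_(i)) / (Z(T) ∩ T_(i+1)), 𝔽_p)` for `2 ≤ i ≤ p`. -/
noncomputable def tInv (i : ℕ) : Cardinal.{v} :=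
  if i = 1 then dimH1 p T (centerTorsion p T) (centralSeries T 2)
  else dimH1 p T (Subgroup.center T ⊓ centralSeries T i) (centralSeries T (i + 1))

/-- The invariant `u = max {i : 1 ≤ i ≤ p, T^p ⊆ T_(i)}`; for `p ≥ 1` the set is finite and
contains `1`. -/
noncomputable def uInv : ℕ :=
  sSup {i : ℕ | 1 ≤ i ∧ i ≤ p ∧ powerSubgroup p T ≤ centralSeries T i}

end Invariants

end TGroups

/-!
A `T`-group `T` is an extension of `ℤ/p` by a profinite `𝔽_p`-vector space `M`: conjugation by a
generator `σ` acts on `M` as `1 + X` with `X ^ p = 0`, and `σ ^ p` is a vector `z` with `X z = 0`.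
Conversely such `X` and `z` determine the extension. On the discrete dual of `M` the transpose of
`X` has a Jordan basis, so that by duality `M` is a product of truncated shifts. The vector `z`
can be moved, by changing the Jordan basis and replacing `σ` by `σ m`, either to `0` or to the
last basis vector of a single block of size less than `p`.

If `T` is not elementary abelian, the centre and the closed lower central series are read off
from `X`: `Z(T)[p] = ker X` and `T_(i+1) = range (X ^ i)` for `i ≥ 1`, so that `t_i` counts the
blocks of size `i`. The size of the block containing `z` is `u`, and `u = p` when `z = 0`. If `T` is
elementary abelian, then `Z(T) = T` and `t_1` counts the class of `σ` besides the blocks.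
-/

namespace TGroups

section Duality

theorem exists_forall_dual_apply_eq {ι K V : Type*} [Finite ι] [Field K] [AddCommGroup V]
    [Module K V] {f : ι → Module.Dual K V} (hf : LinearIndependent K f) (a : ι → K) :
    ∃ v, ∀ i, f i v = a i := by
  have hsurj : Function.Surjective (Finsupp.linearCombination K f).flip :=
    LinearMap.flip_injective_iff₂.mp hf
  obtain ⟨v, hv⟩ := hsurj (Finsupp.linearCombination K a)
  exact ⟨v, fun i => by simpa using DFunLike.congr_fun hv (Finsupp.single i 1)⟩

/- Finitely many conditions are linear algebra; compactness handles all of them at once. -/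
theorem exists_forall_character_eq {ι K M : Type*} [Field K] [TopologicalSpace K]
    [IsTopologicalRing K] [T2Space K] [AddCommGroup M] [Module K M] [TopologicalSpace M]
    [CompactSpace M] {χ : ι → M →L[K] K} (hχ : LinearIndependent K χ) (a : ι → K) :
    ∃ m, ∀ i, χ i m = a i := by
  have hχ' : LinearIndependent K fun i => (χ i : Module.Dual K M) :=
    hχ.map' (ContinuousLinearMap.coeLM K)
      (LinearMap.ker_eq_bot.mpr ContinuousLinearMap.coe_injective)
  have hne : (⋂ i, {m | χ i m = a i}).Nonempty := by
    refine CompactSpace.iInter_nonempty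
      (fun i => isClosed_eq (χ i).continuous continuous_const) fun J => ?_
    obtain ⟨m, hm⟩ := exists_forall_dual_apply_eq
      (hχ'.comp (fun i : J => (i : ι)) Subtype.val_injective) (fun i => a i)
    exact ⟨m, Set.mem_iInter₂.mpr fun i hi => hm ⟨i, hi⟩⟩
  obtain ⟨m, hm⟩ := hne
  exact ⟨m, Set.mem_iInter.mp hm⟩

variable {p : ℕ} [Fact p.Prime] {M : Type*} [AddCommGroup M] [Module (ZMod p) M]
  [TopologicalSpace M] [IsTopologicalAddGroup M] [CompactSpace M] [TotallyDisconnectedSpace M]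

theorem exists_character_ne_zero {m : M} (hm : m ≠ 0) : ∃ χ : M →L[ZMod p] ZMod p, χ m ≠ 0 := by
  have : T2Space M := inferInstance
  obtain ⟨U, hU⟩ := ProfiniteGrp.exist_openNormalAddSubgroup_sub_open_nhds_of_zero
    (G := M) (U := {m}ᶜ) isOpen_compl_singleton (by simpa using hm.symm)
  have hmU : m ∉ AddSubgroup.toZModSubmodule p U.toAddSubgroup := fun h =>
    hU (show m ∈ (U : Set M) from h) rfl
  obtain ⟨f, hfm, hle⟩ := Submodule.exists_le_ker_of_notMem hmU
  refine ⟨⟨f, continuous_of_continuousAt_zero f ?_⟩, hfm⟩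
  rw [ContinuousAt, map_zero, nhds_discrete (ZMod p), Filter.tendsto_pure]
  filter_upwards [U.isOpen'.mem_nhds U.zero_mem] with x hx using hle hx

theorem eq_of_forall_character_eq {ι : Type*} {χ : ι → M →L[ZMod p] ZMod p}
    (hχ : ⊤ ≤ Submodule.span (ZMod p) (Set.range χ)) {m n : M} (h : ∀ i, χ i m = χ i n) :
    m = n := by
  by_contra hmn
  obtain ⟨ψ, hψ⟩ := exists_character_ne_zero (p := p) (sub_ne_zero.mpr hmn)
  let ev : (M →L[ZMod p] ZMod p) →ₗ[ZMod p] ZMod p :=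
    (LinearMap.applyₗ (m - n)).comp (ContinuousLinearMap.coeLM (ZMod p))
  have hle : ⊤ ≤ LinearMap.ker ev := hχ.trans <| Submodule.span_le.mpr <| by
    rintro _ ⟨i, rfl⟩
    exact (map_sub (χ i) m n).trans (sub_eq_zero.mpr (h i))
  exact hψ (hle (Submodule.mem_top (x := ψ)))

end Duality

section FirstCohomology

theorem exists_finset_forall_apply_eq_sum {I R N : Type*} [DecidableEq I] [Ring R]
    [TopologicalSpace R] [AddCommGroup N] [Module R N] [TopologicalSpace N] [DiscreteTopology N]
    (ψ : (I → R) →L[R] N) :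
    ∃ s : Finset I, ∀ x, ψ x = ∑ i ∈ s, x i • ψ (Pi.single i 1) := by
  have hnhds : {x | ψ x = 0} ∈ nhds (0 : I → R) :=
    ((isOpen_discrete {(0 : N)}).preimage ψ.continuous).mem_nhds (map_zero ψ)
  rw [nhds_pi, Filter.mem_pi] at hnhds
  obtain ⟨J, hJ, t, ht, hsub⟩ := hnhds
  have hker : ∀ x : I → R, (∀ i ∈ J, x i = 0) → ψ x = 0 := fun x hx =>
    hsub fun i hi => by rw [hx i hi]; exact mem_of_mem_nhds (ht i)
  refine ⟨hJ.toFinset, fun x => ?_⟩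
  have hrest : ψ (x - ∑ i ∈ hJ.toFinset, x i • Pi.single i (1 : R)) = 0 :=
    hker _ fun i hi => by simp [Finset.sum_apply, Pi.single_apply, hi]
  simpa only [map_sub, map_sum, map_smul, sub_eq_zero] using hrest

variable {p : ℕ} {Q I : Type v} [Group Q] [TopologicalSpace Q]

/-- The characters `Q → 𝔽_p` given by the coordinates of an isomorphism `Q ≃ 𝔽_p ^ I`. -/
def coordCharacter (e : Q ≃ₜ* Multiplicative (I → ZMod p)) (i : I) : H1 p Q :=
  ⟨fun q => (e q).toAdd i, (continuous_apply i).comp (continuous_toAdd.comp e.continuous),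
    fun a b => congrArg (fun x => x.toAdd i) (map_mul e a b)⟩

theorem linearIndependent_coordCharacter (e : Q ≃ₜ* Multiplicative (I → ZMod p)) :
    LinearIndependent (ZMod p) (coordCharacter e) := by
  classical
  refine linearIndependent_iff'.mpr fun s a h i hi => ?_
  have h1 := congrFun (congrArg Subtype.val h) (e.symm (Multiplicative.ofAdd (Pi.single i 1)))
  simpa [coordCharacter, Finset.sum_apply, Pi.single_apply, hi] using h1

theorem span_coordCharacter_eq_top (e : Q ≃ₜ* Multiplicative (I → ZMod p)) :
    Submodule.span (ZMod p) (Set.range (coordCharacter e)) = ⊤ := by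
  classical
  refine eq_top_iff.mpr ?_
  rintro ⟨χ, hcont, hχ⟩ -
  let ψ : (I → ZMod p) →L[ZMod p] ZMod p :=
    ⟨(AddMonoidHom.mk' (fun x => χ (e.symm (Multiplicative.ofAdd x)))
      fun x y => by rw [ofAdd_add, map_mul, hχ]).toZModLinearMap p,
      hcont.comp (e.symm.continuous.comp continuous_ofAdd)⟩
  obtain ⟨s, hs⟩ := exists_finset_forall_apply_eq_sum ψ
  have hsum : (⟨χ, hcont, hχ⟩ : H1 p Q) = ∑ i ∈ s, ψ (Pi.single i 1) • coordCharacter e i := by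
    refine Subtype.ext (funext fun q => ?_)
    calc χ q = ψ (e q).toAdd := congrArg χ (e.symm_apply_apply q).symm
      _ = ∑ i ∈ s, (e q).toAdd i • ψ (Pi.single i 1) := hs _
      _ = (∑ i ∈ s, ψ (Pi.single i 1) • coordCharacter e i : H1 p Q).1 q := by
        simp [coordCharacter, Finset.sum_apply, mul_comm]
  rw [hsum]
  exact Submodule.sum_mem _ fun i _ => Submodule.smul_mem _ _ (Submodule.subset_span ⟨i, rfl⟩)

theorem rank_H1_eq [Fact p.Prime] (e : Q ≃ₜ* Multiplicative (I → ZMod p)) :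
    Module.rank (ZMod p) (H1 p Q) = Cardinal.mk I :=
  (Module.Basis.mk (linearIndependent_coordCharacter e)
    (span_coordCharacter_eq_top e).ge).mk_eq_rank''.symm

end FirstCohomology

section LinearAlgebra

theorem linearIndependent_of_filtration {ι κ R V : Type*} [Ring R] [AddCommGroup V] [Module R V]
    [LinearOrder κ] {v : ι → V} {deg : ι → κ} {F : κ → Submodule R V}
    (hlt : ∀ i k, k < deg i → v i ∈ F k)
    (hind : ∀ k, LinearIndependent R fun i : {i // deg i = k} => (F k).mkQ (v i)) :
    LinearIndependent R v := by
  classical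
  refine linearIndependent_iff.mpr fun l hl => ?_
  by_contra hne
  obtain ⟨i₀, hi₀, hmin⟩ :=
    l.support.exists_min_image deg (Finsupp.support_nonempty_iff.mpr hne)
  have hhigher : ∀ i ∈ l.support, deg i ≠ deg i₀ → (F (deg i₀)).mkQ (l i • v i) = 0 := by
    intro i hi hdeg
    rw [Submodule.mkQ_apply, Submodule.Quotient.mk_eq_zero]
    exact Submodule.smul_mem _ _ (hlt _ _ (lt_of_le_of_ne (hmin i hi) hdeg.symm))
  have hsum : ∑ i ∈ l.support.subtype (deg · = deg i₀), l i • (F (deg i₀)).mkQ (v i) = 0 := by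
    have h0 := congrArg (F (deg i₀)).mkQ hl
    rw [Finsupp.linearCombination_apply, Finsupp.sum, map_sum, map_zero,
      ← Finset.sum_filter_of_ne fun i hi => not_imp_comm.mp (hhigher i hi)] at h0
    simpa only [← map_smul, ← Finset.sum_subtype_eq_sum_filter] using h0
  exact Finsupp.mem_support_iff.mp hi₀ <|
    linearIndependent_iff'.mp (hind _) _ (fun i => l i) hsum ⟨i₀, rfl⟩ (by simpa using hi₀)

end LinearAlgebra

section Jordan

/-- The blocks of a Jordan decomposition, indexed by `Index`, and their sizes `len`, all between `1`
and `n`. -/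
structure JordanType (n : ℕ) where
  Index : Type v
  len : Index → ℕ
  one_le_len : ∀ b, 1 ≤ len b
  len_le : ∀ b, len b ≤ n

variable {K : Type*} [Ring K] {V : Type v} [AddCommGroup V] [Module K V]

/-- Generators `w b` of the blocks of a Jordan decomposition of type `J` of the nilpotent
endomorphism `X`: the vectors `X ^ j (w b)` with `j < J.len b` form a basis. -/
structure IsJordanFamily (X : Module.End K V) {n : ℕ} (J : JordanType.{v} n) (w : J.Index → V) :
    Prop where
  pow_len_eq_zero : ∀ b, (X ^ J.len b) (w b) = 0
  indep : LinearIndependent K fun i : Σ b, Fin (J.len b) => (X ^ (i.2 : ℕ)) (w i.1)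
  span : ⊤ ≤ Submodule.span K (Set.range fun i : Σ b, Fin (J.len b) => (X ^ (i.2 : ℕ)) (w i.1))

/-- The vectors of the kernel of `X` of height at least `k`. -/
def socle {R M : Type*} [Semiring R] [AddCommMonoid M] [Module R M] (X : Module.End R M) (k : ℕ) :
    Submodule R M :=
  LinearMap.ker X ⊓ LinearMap.range (X ^ k)

variable {X : Module.End K V} {n k : ℕ}

theorem socle_antitone (X : Module.End K V) : Antitone (socle X) :=
  fun _ _ h => inf_le_inf_left _ (LinearMap.iterateRange X |>.monotone h)

theorem pow_apply_mem_socle {v : V} (hv : (X ^ (k + 1)) v = 0) : (X ^ k) v ∈ socle X k :=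
  ⟨by rwa [pow_succ', Module.End.mul_apply] at hv, v, rfl⟩

theorem ker_pow_le_of_socle_le_map {S : Submodule K V} (h : ∀ k, socle X k ≤ S.map (X ^ k)) :
    ∀ k, LinearMap.ker (X ^ k) ≤ S
  | 0, v, hv => (show v = 0 from hv) ▸ zero_mem S
  | k + 1, v, hv => by
    obtain ⟨s, hs, hsv⟩ := h k (pow_apply_mem_socle hv)
    have hvs : v - s ∈ S :=
      ker_pow_le_of_socle_le_map h k (by rw [LinearMap.mem_ker, map_sub, hsv, sub_self])
    simpa using add_mem hvs hs

theorem socle_le_map_of_le_sup {S : Submodule K V} (hX : X ^ n = 0) (hS : S ≤ S.comap X)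
    (h : ∀ k, socle X k ≤ S.map (X ^ k) ⊔ socle X (k + 1)) (k : ℕ) :
    socle X k ≤ S.map (X ^ k) := by
  induction hd : n - k generalizing k with
  | zero =>
    rintro _ ⟨-, v, rfl⟩
    rw [pow_eq_zero_of_le (Nat.sub_eq_zero_iff_le.mp hd) hX]
    exact zero_mem _
  | succ d ih =>
    refine (h k).trans (sup_le le_rfl ((ih (k + 1) (by omega)).trans ?_))
    rw [pow_succ, Module.End.mul_eq_comp, Submodule.map_comp]
    exact Submodule.map_mono (Submodule.map_le_iff_le_comap.mpr hS)

/-- A choice of generators of the Jordan blocks of size `k + 1` of `X`: the ends `X ^ k (w a)` of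
the blocks are a basis of `socle X k` modulo `socle X (k + 1)`. -/
structure IsBlockFamily (X : Module.End K V) (k : ℕ) {ι : Type*} (w : ι → V) : Prop where
  pow_succ_eq_zero : ∀ a, (X ^ (k + 1)) (w a) = 0
  indep : LinearIndependent K fun a => (socle X (k + 1)).mkQ ((X ^ k) (w a))
  le : socle X k ≤ Submodule.span K (Set.range fun a => (X ^ k) (w a)) ⊔ socle X (k + 1)

theorem exists_isBlockFamily {K : Type*} [DivisionRing K] [Module K V] (X : Module.End K V)
    (k : ℕ) :
    ∃ (ι : Type v) (w : ι → V), IsBlockFamily X k w := by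
  let C := (socle X k).map (socle X (k + 1)).mkQ
  let b := Module.Basis.ofVectorSpace K C
  have hlift : ∀ a, ∃ w, (X ^ k) w ∈ socle X k ∧ (socle X (k + 1)).mkQ ((X ^ k) w) = b a := by
    intro a
    obtain ⟨_, ⟨hker, w, rfl⟩, hw⟩ := (b a).2
    exact ⟨w, ⟨hker, w, rfl⟩, hw⟩
  choose w hsocle hw using hlift
  have hb : (fun a => (socle X (k + 1)).mkQ ((X ^ k) (w a))) = C.subtype ∘ b := funext hw
  refine ⟨_, w, fun a => ?_, ?_, ?_⟩
  · rw [pow_succ', Module.End.mul_apply]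
    exact (hsocle a).1
  · rw [hb]
    exact b.linearIndependent.map' C.subtype C.ker_subtype
  · rw [sup_comm, ← Submodule.comap_map_mkQ, ← Submodule.map_le_iff_le_comap,
      Submodule.map_span, ← Set.range_comp]
    change C ≤ Submodule.span K (Set.range fun a => (socle X (k + 1)).mkQ ((X ^ k) (w a)))
    rw [hb, Set.range_comp, ← Submodule.map_span, b.span_eq, Submodule.map_top,
      Submodule.range_subtype]

section BlockFamilies

variable {ι : ℕ → Type v} {w : ∀ k, ι k → V}

theorem linearIndependent_blockEnds (h : ∀ k, IsBlockFamily X k (w k)) :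
    LinearIndependent K fun b : Σ k, ι k => (X ^ b.1) (w b.1 b.2) := by
  refine linearIndependent_of_filtration (deg := Sigma.fst) (F := fun k => socle X (k + 1))
    (fun b k hk => socle_antitone X hk (pow_apply_mem_socle ((h b.1).pow_succ_eq_zero b.2)))
    fun k => (linearIndependent_equiv' (Equiv.sigmaSubtype k) ?_).mpr (h k).indep
  funext ⟨⟨_, a⟩, rfl⟩
  rfl

theorem linearIndependent_blocks {β : Type*} {len : β → ℕ} {w : β → V}
    (hzero : ∀ b, (X ^ len b) (w b) = 0)
    (hind : LinearIndependent K fun b => (X ^ (len b - 1)) (w b)) :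
    LinearIndependent K fun i : Σ b, Fin (len b) => (X ^ (i.2 : ℕ)) (w i.1) := by
  let deg : (Σ b, Fin (len b)) → ℕᵒᵈ := fun i => OrderDual.toDual (len i.1 - 1 - i.2)
  refine linearIndependent_of_filtration (deg := deg)
    (F := fun d => LinearMap.ker (X ^ OrderDual.ofDual d)) (fun i d hd => ?_) fun d => ?_
  · have hle : len i.1 ≤ OrderDual.ofDual d + i.2 := by
      have : len i.1 - 1 - i.2 < OrderDual.ofDual d := hd
      omega
    rw [LinearMap.mem_ker, ← Module.End.mul_apply, ← pow_add, ← Nat.sub_add_cancel hle, pow_add,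
      Module.End.mul_apply, hzero, map_zero]
  · have hd : ∀ i : {i // deg i = d}, OrderDual.ofDual d + i.1.2 = len i.1.1 - 1 := by
      rintro ⟨i, rfl⟩
      exact Nat.sub_add_cancel (Nat.le_sub_one_of_lt i.2.2)
    have hinj : Function.Injective fun i : {i // deg i = d} => i.1.1 := by
      rintro ⟨⟨b, j⟩, hj⟩ ⟨⟨_, j'⟩, hj'⟩ rfl
      obtain rfl : j = j' :=
        Fin.ext (Nat.add_left_cancel ((hd ⟨_, hj⟩).trans (hd ⟨_, hj'⟩).symm))
      rfl
    refine LinearIndependent.of_comp ((LinearMap.ker (X ^ OrderDual.ofDual d)).liftQ _ le_rfl) ?_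
    have hends := hind.comp _ hinj
    simp only [Function.comp_def, ← hd, pow_add, Module.End.mul_apply] at hends
    exact hends

theorem span_blocks_eq_top (hX : X ^ n = 0) (h : ∀ k, IsBlockFamily X k (w k)) :
    Submodule.span K (Set.range fun i : Σ b : (Σ k, ι k), Fin (b.1 + 1) =>
      (X ^ (i.2 : ℕ)) (w i.1.1 i.1.2)) = ⊤ := by
  set S := Submodule.span K (Set.range fun i : Σ b : (Σ k, ι k), Fin (b.1 + 1) =>
    (X ^ (i.2 : ℕ)) (w i.1.1 i.1.2))
  have hmem : ∀ k (a : ι k), ∀ j < k + 1, (X ^ j) (w k a) ∈ S := fun k a j hj =>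
    Submodule.subset_span ⟨⟨⟨k, a⟩, ⟨j, hj⟩⟩, rfl⟩
  have hinv : S ≤ S.comap X := by
    refine Submodule.span_le.mpr ?_
    rintro _ ⟨⟨⟨k, a⟩, j⟩, rfl⟩
    simp only [SetLike.mem_coe, Submodule.mem_comap, ← Module.End.mul_apply, ← pow_succ']
    rcases (Nat.succ_le_of_lt j.2).lt_or_eq with hj | hj
    · exact hmem k a _ hj
    · rw [← Nat.succ_eq_add_one, hj, (h k).pow_succ_eq_zero]
      exact zero_mem _
  have hends : ∀ k, Submodule.span K (Set.range fun a => (X ^ k) (w k a)) ≤ S.map (X ^ k) := by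
    refine fun k => Submodule.span_le.mpr ?_
    rintro _ ⟨a, rfl⟩
    exact ⟨w k a, hmem k a 0 k.succ_pos, rfl⟩
  have hsocle := socle_le_map_of_le_sup hX hinv fun k =>
    (h k).le.trans (sup_le_sup_right (hends k) _)
  refine top_le_iff.mp (le_trans ?_ (ker_pow_le_of_socle_le_map hsocle n))
  rw [hX, LinearMap.ker_zero]

end BlockFamilies

theorem exists_isJordanFamily {K : Type*} [DivisionRing K] [Module K V] {X : Module.End K V}
    (hX : X ^ n = 0) :
    ∃ (J : JordanType.{v} n) (w : J.Index → V), IsJordanFamily X J w := by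
  choose ι w h using exists_isBlockFamily X
  let J : JordanType.{v} n :=
    { Index := Σ k, ι k
      len := fun b => b.1 + 1
      one_le_len := fun b => b.1.succ_pos
      len_le := fun ⟨k, a⟩ => by
        by_contra! hk
        refine (h k).indep.ne_zero a ?_
        rw [pow_eq_zero_of_le (Nat.lt_succ_iff.mp hk) hX, LinearMap.zero_apply, map_zero] }
  exact ⟨J, fun b => w b.1 b.2, fun b => (h b.1).pow_succ_eq_zero b.2,
    linearIndependent_blocks (len := J.len) (fun b => (h b.1).pow_succ_eq_zero b.2)
      (linearIndependent_blockEnds h),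
    (span_blocks_eq_top hX h).ge⟩

end Jordan

section CoordinateSpace

namespace JordanType

section Shift

variable {n : ℕ} (J : JordanType.{v} n) (K : Type*) [Semiring K]

/-- The product, over the blocks `b`, of the spaces `K ^ (len b)`, realized as a space of functions
extended by zero. -/
def space : Submodule K (J.Index → ℕ → K) where
  carrier := {m | ∀ b j, J.len b ≤ j → m b j = 0}
  zero_mem' _ _ _ := rfl
  add_mem' {m m'} hm hm' b j h := by
    rw [Pi.add_apply, Pi.add_apply, hm b j h, hm' b j h, add_zero]
  smul_mem' c m hm b j h := by rw [Pi.smul_apply, Pi.smul_apply, hm b j h, smul_zero]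

/-- The shift operator, a product of nilpotent Jordan blocks of sizes `len b`. -/
def shift : Module.End K (J.space K) where
  toFun m := ⟨fun b j => m.1 b (j + 1), fun b j h => m.2 b (j + 1) (h.trans j.le_succ)⟩
  map_add' _ _ := rfl
  map_smul' _ _ := rfl

open Classical in
/-- The vector of the block `b₀` with coordinates `(1, 0, …, 0)`; it spans the kernel of the shift
on that block. -/
noncomputable def unitVec (b₀ : J.Index) : J.space K :=
  ⟨Pi.single b₀ (Pi.single 0 1), fun b j hj => by
    have hj0 : j ≠ 0 := by have := J.one_le_len b; omega
    rcases eq_or_ne b b₀ with rfl | hb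
    · rw [Pi.single_eq_same, Pi.single_eq_of_ne hj0]
    · rw [Pi.single_eq_of_ne hb, Pi.zero_apply]⟩

variable {J K} {m : J.space K} {k : ℕ}

theorem shift_apply (m : J.space K) (b : J.Index) (j : ℕ) : (J.shift K m).1 b j = m.1 b (j + 1) :=
  rfl

theorem shift_pow_apply (k : ℕ) (m : J.space K) (b : J.Index) (j : ℕ) :
    ((J.shift K ^ k) m).1 b j = m.1 b (j + k) := by
  induction k generalizing m with
  | zero => rfl
  | succ k ih => rw [pow_succ, Module.End.mul_apply, ih, shift_apply, add_assoc]

theorem mem_range_shift_pow :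
    m ∈ LinearMap.range (J.shift K ^ k) ↔ ∀ b j, J.len b ≤ j + k → m.1 b j = 0 := by
  constructor
  · rintro ⟨m, rfl⟩ b j h
    rw [shift_pow_apply]
    exact m.2 b _ h
  · intro h
    refine ⟨⟨fun b j => if k ≤ j then m.1 b (j - k) else 0, fun b j hj => ?_⟩, ?_⟩
    · dsimp only
      split_ifs with hk
      · exact h b _ (hj.trans (Nat.sub_add_cancel hk).ge)
      · rfl
    · ext b j
      rw [shift_pow_apply]
      simp

theorem shift_eq_zero_iff : J.shift K m = 0 ↔ ∀ b j, m.1 b (j + 1) = 0 :=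
  ⟨fun h b j => by rw [← shift_apply, h]; rfl, fun h => Subtype.ext (funext₂ h)⟩

theorem shift_pow_eq_zero (J : JordanType.{v} n) (K : Type*) [Semiring K] :
    J.shift K ^ n = 0 := by
  ext m b j
  rw [shift_pow_apply]
  exact m.2 b _ ((J.len_le b).trans (Nat.le_add_left _ _))

theorem unitVec_apply_self (b₀ : J.Index) : (J.unitVec K b₀).1 b₀ 0 = 1 := by
  simp [unitVec]

theorem unitVec_apply_of_ne {b₀ b : J.Index} (hb : b ≠ b₀) (j : ℕ) :
    (J.unitVec K b₀).1 b j = 0 := by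
  simp [unitVec, hb]

theorem shift_unitVec (b₀ : J.Index) : J.shift K (J.unitVec K b₀) = 0 := by
  refine shift_eq_zero_iff.mpr fun b j => ?_
  rcases eq_or_ne b b₀ with rfl | hb
  · simp [unitVec]
  · exact unitVec_apply_of_ne hb _

theorem eq_of_shift_eq_zero {m' : J.space K} (hm : J.shift K m = 0) (hm' : J.shift K m' = 0)
    (h : ∀ b, m.1 b 0 = m'.1 b 0) : m = m' := by
  ext b j
  cases j with
  | zero => exact h b
  | succ j => rw [shift_eq_zero_iff.mp hm, shift_eq_zero_iff.mp hm']

section Topology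

variable [TopologicalSpace K]

theorem continuous_shift : Continuous (J.shift K) := by
  refine Continuous.subtype_mk (continuous_pi fun b => continuous_pi fun j => ?_) _
  exact (continuous_apply_apply b (j + 1)).comp continuous_subtype_val

theorem isClosed_space [T1Space K] : IsClosed (J.space K : Set (J.Index → ℕ → K)) := by
  have h : (J.space K : Set (J.Index → ℕ → K)) =
      ⋂ b, ⋂ j, ⋂ (_ : J.len b ≤ j), {m | m b j = 0} := by
    ext m
    simp only [Set.mem_iInter]
    rfl
  rw [h]
  exact isClosed_iInter fun b => isClosed_iInter fun j => isClosed_iInter fun _ =>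
    isClosed_singleton.preimage (continuous_apply_apply b j)

instance [T1Space K] [CompactSpace K] : CompactSpace (J.space K) :=
  isCompact_iff_compactSpace.mp isClosed_space.isCompact

end Topology

end Shift

section AddBlock

variable {n : ℕ} {J : JordanType.{v} n} {K : Type*} [Field K] {b₀ : J.Index} {c : J.Index → K}

/-- The endomorphism of the coordinate space that adds `c b` times the block `b₀` to each block
`b`. -/
def addBlock (b₀ : J.Index) (c : J.Index → K) (hc : ∀ b, c b ≠ 0 → J.len b₀ ≤ J.len b) :
    Module.End K (J.space K) where
  toFun m := ⟨fun b j => m.1 b j + c b * m.1 b₀ j, fun b j hj => by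
    dsimp only
    rcases eq_or_ne (c b) 0 with hb | hb
    · rw [m.2 b j hj, hb, zero_mul, add_zero]
    · rw [m.2 b j hj, m.2 b₀ j ((hc b hb).trans hj), mul_zero, add_zero]⟩
  map_add' m m' := by ext b j; simp; ring
  map_smul' a m := by ext b j; simp; ring

theorem addBlock_apply (hc : ∀ b, c b ≠ 0 → J.len b₀ ≤ J.len b) (m : J.space K) (b : J.Index)
    (j : ℕ) : (addBlock b₀ c hc m).1 b j = m.1 b j + c b * m.1 b₀ j :=
  rfl

theorem addBlock_shift (hc : ∀ b, c b ≠ 0 → J.len b₀ ≤ J.len b) (m : J.space K) :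
    addBlock b₀ c hc (J.shift K m) = J.shift K (addBlock b₀ c hc m) :=
  rfl

theorem continuous_addBlock [TopologicalSpace K] [IsTopologicalRing K]
    (hc : ∀ b, c b ≠ 0 → J.len b₀ ≤ J.len b) : Continuous (addBlock b₀ c hc) := by
  refine Continuous.subtype_mk (continuous_pi fun b => continuous_pi fun j => ?_) _
  have hcoord : ∀ b, Continuous fun m : J.space K => m.1 b j := fun b =>
    (continuous_apply_apply b j).comp continuous_subtype_val
  exact (hcoord b).add (continuous_const.mul (hcoord b₀))

theorem bijective_addBlock (hc : ∀ b, c b ≠ 0 → J.len b₀ ≤ J.len b) (h₀ : 1 + c b₀ ≠ 0) :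
    Function.Bijective (addBlock b₀ c hc) := by
  refine Function.bijective_iff_has_inverse.mpr
    ⟨addBlock b₀ (fun b => -c b / (1 + c b₀)) fun b hb => hc b ?_, fun m => ?_, fun m => ?_⟩
  · rintro h0
    simp [h0] at hb
  all_goals
    ext b j
    simp only [addBlock_apply]
    field_simp
    ring

/- A vector killed by the shift becomes a unit vector once the smallest block that it involves is
added, with suitable coefficients, to the other blocks that it involves. -/
theorem exists_addBlock_unitVec_eq {z : J.space K} (hz : J.shift K z = 0) (hz0 : z ≠ 0) :
    ∃ (b₀ : J.Index) (c : J.Index → K) (hc : ∀ b, c b ≠ 0 → J.len b₀ ≤ J.len b),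
      (∀ b, z.1 b 0 ≠ 0 → J.len b₀ ≤ J.len b) ∧ 1 + c b₀ ≠ 0 ∧
        addBlock b₀ c hc (J.unitVec K b₀) = z := by
  have hsupp : {b | z.1 b 0 ≠ 0}.Nonempty := by
    by_contra! h
    exact hz0 (eq_of_shift_eq_zero hz (map_zero _) fun b => by
      simpa using Set.eq_empty_iff_forall_notMem.mp h b)
  let b₀ := Function.argminOn J.len _ hsupp
  have hb₀ : z.1 b₀ 0 ≠ 0 := Function.argminOn_mem J.len _ hsupp
  have hmin : ∀ b, z.1 b 0 ≠ 0 → J.len b₀ ≤ J.len b := fun b hb =>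
    Function.argminOn_le J.len _ hb
  have hc : ∀ b, z.1 b 0 - (J.unitVec K b₀).1 b 0 ≠ 0 → J.len b₀ ≤ J.len b := by
    intro b hb
    rcases eq_or_ne b b₀ with rfl | hne
    · exact le_rfl
    · exact hmin b (by rwa [unitVec_apply_of_ne hne, sub_zero] at hb)
  refine ⟨b₀, _, hc, hmin, by rwa [unitVec_apply_self, add_sub_cancel], ?_⟩
  refine eq_of_shift_eq_zero (by rw [← addBlock_shift, shift_unitVec, map_zero]) hz fun b => ?_
  rw [addBlock_apply, unitVec_apply_self, mul_one, add_sub_cancel]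

end AddBlock

end JordanType

end CoordinateSpace

section Coordinatization

/-- A bijective continuous linear map from a compact space to a Hausdorff space, as an
isomorphism. -/
noncomputable def continuousLinearEquivOfBijective {R M N : Type*} [Semiring R] [AddCommMonoid M]
    [AddCommMonoid N] [Module R M] [Module R N] [TopologicalSpace M] [TopologicalSpace N]
    [CompactSpace M] [T2Space N] (f : M →L[R] N) (hf : Function.Bijective f) : M ≃L[R] N where
  toLinearEquiv := LinearEquiv.ofBijective (f : M →ₗ[R] N) hf
  continuous_toFun := f.continuous
  continuous_invFun := Continuous.continuous_symm_of_equiv_compact_to_t2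
    (f := (LinearEquiv.ofBijective (f : M →ₗ[R] N) hf).toEquiv) f.continuous

theorem continuous_end_pow {R : Type*} [Semiring R] {M : Type*} [AddCommMonoid M] [Module R M]
    [TopologicalSpace M] {x : Module.End R M} (hx : Continuous x) (k : ℕ) :
    Continuous (x ^ k) := by
  rw [Module.End.coe_pow]
  exact hx.iterate k

section JordanCoordinates

variable {R : Type*} [CommRing R] [TopologicalSpace R] [IsTopologicalRing R] {M : Type*}
  [AddCommGroup M] [Module R M] [TopologicalSpace M] {x : Module.End R M} (hx : Continuous x)

/-- The endomorphism of the space of continuous characters given by composition with `x`. -/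
def characterTranspose : Module.End R (M →L[R] R) where
  toFun χ := χ.comp ⟨x, hx⟩
  map_add' _ _ := rfl
  map_smul' _ _ := rfl

theorem characterTranspose_pow_apply (j : ℕ) (χ : M →L[R] R) (m : M) :
    (characterTranspose hx ^ j) χ m = χ ((x ^ j) m) := by
  induction j generalizing χ with
  | zero => rfl
  | succ j ih => rw [pow_succ, Module.End.mul_apply, ih, pow_succ']; rfl

variable {hx} {n : ℕ} {J : JordanType n} {w : J.Index → M →L[R] R}

/-- The coordinates of a vector with respect to a Jordan family of characters. -/
def jordanCoord (hw : IsJordanFamily (characterTranspose hx) J w) :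
    M →L[R] J.space R where
  toFun m := ⟨fun b j => w b ((x ^ j) m), fun b j hj => by
    change w b ((x ^ j) m) = 0
    rw [← characterTranspose_pow_apply hx, ← Nat.sub_add_cancel hj, pow_add, Module.End.mul_apply,
      hw.pow_len_eq_zero, map_zero]
    rfl⟩
  map_add' m m' := by ext b j; simp
  map_smul' c m := by ext b j; simp
  cont := Continuous.subtype_mk (continuous_pi fun b => continuous_pi fun j =>
    (w b).continuous.comp (continuous_end_pow hx j)) _

theorem jordanCoord_apply (hw : IsJordanFamily (characterTranspose hx) J w) (m : M) :
    jordanCoord hw (x m) = J.shift R (jordanCoord hw m) := by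
  ext b j
  change w b ((x ^ j) (x m)) = w b ((x ^ (j + 1)) m)
  rw [pow_succ]
  rfl

end JordanCoordinates

variable {p : ℕ} [Fact p.Prime] {M : Type v} [AddCommGroup M] [Module (ZMod p) M]
  [TopologicalSpace M] [CompactSpace M] [IsTopologicalAddGroup M] [TotallyDisconnectedSpace M]
  {n : ℕ} {x : Module.End (ZMod p) M}

theorem bijective_jordanCoord {hx : Continuous x} {J : JordanType n}
    {w : J.Index → M →L[ZMod p] ZMod p} (hw : IsJordanFamily (characterTranspose hx) J w) :
    Function.Bijective (jordanCoord hw) := by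
  constructor
  · intro m m' h
    refine eq_of_forall_character_eq hw.span fun ⟨b, j⟩ => ?_
    rw [characterTranspose_pow_apply, characterTranspose_pow_apply]
    exact congrFun₂ (congrArg Subtype.val h) b j
  · intro m
    obtain ⟨y, hy⟩ := exists_forall_character_eq hw.indep fun i => m.1 i.1 i.2
    refine ⟨y, ?_⟩
    ext b j
    rcases lt_or_ge j (J.len b) with hj | hj
    · exact (characterTranspose_pow_apply hx j (w b) y).symm.trans (hy ⟨b, ⟨j, hj⟩⟩)
    · rw [(jordanCoord hw y).2 b j hj, m.2 b j hj]

theorem exists_equiv_space (hx : Continuous x) (hxn : x ^ n = 0) :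
    ∃ (J : JordanType.{v} n) (e : M ≃L[ZMod p] J.space (ZMod p)),
      ∀ m, e (x m) = J.shift (ZMod p) (e m) := by
  have hX : characterTranspose hx ^ n = 0 := by
    ext χ m
    rw [characterTranspose_pow_apply, hxn]
    exact map_zero χ
  obtain ⟨J, w, hw⟩ := exists_isJordanFamily hX
  exact ⟨J, continuousLinearEquivOfBijective _ (bijective_jordanCoord hw), jordanCoord_apply hw⟩

theorem exists_equiv_space_of_apply_eq_zero (hx : Continuous x) (hxn : x ^ n = 0) {z : M}
    (hz : x z = 0) :
    ∃ (J : JordanType.{v} n) (e : M ≃L[ZMod p] J.space (ZMod p)),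
      (∀ m, e (x m) = J.shift (ZMod p) (e m)) ∧
        ((∃ b₀, J.len b₀ < n ∧ e z = J.unitVec (ZMod p) b₀) ∨ ∃ y, (x ^ (n - 1)) y = z) := by
  obtain ⟨J, e, he⟩ := exists_equiv_space hx hxn
  rcases eq_or_ne z 0 with rfl | hz0
  · exact ⟨J, e, he, Or.inr ⟨0, map_zero _⟩⟩
  have hez : J.shift (ZMod p) (e z) = 0 := by rw [← he, hz, map_zero]
  obtain ⟨b₀, c, hc, hmin, h₀, hB⟩ :=
    JordanType.exists_addBlock_unitVec_eq hez (e.map_ne_zero_iff.mpr hz0)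
  rcases (J.len_le b₀).lt_or_eq with hlt | heq
  · let B := continuousLinearEquivOfBijective
      ⟨JordanType.addBlock b₀ c hc, JordanType.continuous_addBlock hc⟩
      (JordanType.bijective_addBlock hc h₀)
    have hBshift : ∀ m, B.symm (J.shift (ZMod p) m) = J.shift (ZMod p) (B.symm m) := fun m =>
      B.symm_apply_eq.mpr <| by
        change _ = JordanType.addBlock b₀ c hc _
        rw [JordanType.addBlock_shift]
        exact congrArg _ (B.apply_symm_apply m).symm
    exact ⟨J, e.trans B.symm, fun m => (congrArg B.symm (he m)).trans (hBshift _),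
      Or.inl ⟨b₀, hlt, B.symm_apply_eq.mpr hB.symm⟩⟩
  · have hrange : e z ∈ LinearMap.range (J.shift (ZMod p) ^ (n - 1)) := by
      refine JordanType.mem_range_shift_pow.mpr fun b j hj => ?_
      cases j with
      | zero =>
        by_contra hb
        have := hmin b hb
        have := J.one_le_len b
        omega
      | succ j => exact JordanType.shift_eq_zero_iff.mp hez b j
    obtain ⟨y, hy⟩ := hrange
    have hsemi := Function.Semiconj.iterate_right (f := e) he (n - 1)
    refine ⟨J, e, he, Or.inr ⟨e.symm y, e.injective ?_⟩⟩
    rw [← hy, Module.End.pow_apply, hsemi, e.apply_symm_apply, Module.End.pow_apply]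

end Coordinatization

section PrimeCharacteristic

variable {p : ℕ} [Fact p.Prime] {A : Type*} [Ring A]

theorem exists_one_add_pow_eq (x : A) (a : ℕ) : ∃ q, Commute x q ∧ (1 + x) ^ a = 1 + x * q := by
  refine ⟨∑ j ∈ Finset.range a, (1 + x) ^ j, ?_, ?_⟩
  · exact Commute.sum_right _ _ _ fun j _ =>
      ((Commute.one_right x).add_right (Commute.refl x)).pow_right j
  · have h := mul_geom_sum (1 + x) a
    rw [add_sub_cancel_left] at h
    rw [h, add_sub_cancel]

variable [Algebra (ZMod p) A] (x : A)

open Polynomial in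
theorem one_add_pow_prime : (1 + x) ^ p = 1 + x ^ p := by
  have h : (1 + X : (ZMod p)[X]) ^ p = 1 + X ^ p := by rw [add_pow_char, one_pow]
  simpa only [map_add, map_one, map_pow, aeval_X] using congrArg (aeval x) h

open Polynomial in
theorem geom_sum_one_add : ∑ j ∈ Finset.range p, (1 + x) ^ j = x ^ (p - 1) := by
  have h : ∑ j ∈ Finset.range p, (1 + X : (ZMod p)[X]) ^ j = X ^ (p - 1) := by
    apply mul_right_cancel₀ (X_ne_zero (R := ZMod p))
    have hgeom := geom_sum_mul (1 + X : (ZMod p)[X]) p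
    rw [add_sub_cancel_left] at hgeom
    rw [hgeom, add_pow_char, one_pow, add_sub_cancel_left, ← pow_succ,
      Nat.sub_add_cancel (Fact.out : p.Prime).one_le]
  simpa only [map_sum, map_add, map_one, map_pow, aeval_X] using congrArg (aeval x) h

theorem exists_geom_sum_one_add_pow_eq (a : ℕ) :
    ∃ q, ∑ j ∈ Finset.range p, ((1 + x) ^ a) ^ j = x ^ (p - 1) * q := by
  obtain ⟨q, hq, h⟩ := exists_one_add_pow_eq x a
  exact ⟨q ^ (p - 1), by rw [h, geom_sum_one_add, hq.mul_pow]⟩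

end PrimeCharacteristic

/-- The data describing an extension of `ℤ/p` by an elementary abelian group `M`: a lift of a
generator of `ℤ/p` acts on `M` by conjugation as `1 + op`, and its `p`-th power is `z`. -/
structure CyclicDatum (p : ℕ) (M : Type v) [AddCommGroup M] [Module (ZMod p) M]
    [TopologicalSpace M] where
  op : Module.End (ZMod p) M
  op_pow : op ^ p = 0
  continuous_op : Continuous op
  z : M
  op_z : op z = 0

/-- A realization of `T` as an extension of `ℤ/p` by `M` described by `D`: an embedding `φ` of `M`
in `T` and a lift `σ` of a generator of `ℤ/p`. -/
structure Presentation {p : ℕ} {M : Type v} [AddCommGroup M] [Module (ZMod p) M]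
    [TopologicalSpace M] (D : CyclicDatum p M) (T : Type v) [Group T] [TopologicalSpace T] where
  φ : M → T
  σ : T
  map_add : ∀ m n, φ (m + n) = φ m * φ n
  continuous : Continuous φ
  injective : Function.Injective φ
  σ_mul : ∀ m, σ * φ m = φ (m + D.op m) * σ
  σ_pow : σ ^ p = φ D.z
  φ_ne_σ : ∀ m, φ m ≠ σ
  exists_eq : ∀ t, ∃ m, ∃ k : ℕ, t = φ m * σ ^ k

namespace Presentation

variable {p : ℕ} {M : Type v} [AddCommGroup M] [Module (ZMod p) M]
  [TopologicalSpace M] {D : CyclicDatum p M} {T : Type v} [Group T] [TopologicalSpace T]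
  (P : Presentation D T)

/-- Transport of a presentation along a continuous isomorphism of the kernels. -/
def comp {M' : Type v} [AddCommGroup M'] [Module (ZMod p) M'] [TopologicalSpace M']
    {D' : CyclicDatum p M'} (e : M' ≃ₗ[ZMod p] M) (hc : Continuous e)
    (he : ∀ m, D.op (e m) = e (D'.op m)) (hz : e D'.z = D.z) : Presentation D' T where
  φ m := P.φ (e m)
  σ := P.σ
  map_add m n := by rw [_root_.map_add, P.map_add]
  continuous := P.continuous.comp hc
  injective := P.injective.comp e.injective
  σ_mul m := by rw [P.σ_mul, _root_.map_add, he]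
  σ_pow := by rw [P.σ_pow, hz]
  φ_ne_σ m := P.φ_ne_σ _
  exists_eq t := by
    obtain ⟨m, k, rfl⟩ := P.exists_eq t
    exact ⟨e.symm m, k, by rw [e.apply_symm_apply]⟩

/-- The embedding of the kernel, as a homomorphism. -/
def hom : Multiplicative M →* T :=
  MonoidHom.mk' (fun m => P.φ m.toAdd) fun _ _ => P.map_add _ _

theorem map_zero : P.φ 0 = 1 := P.hom.map_one

theorem map_neg (m : M) : P.φ (-m) = (P.φ m)⁻¹ := P.hom.map_inv (Multiplicative.ofAdd m)

theorem map_nsmul (k : ℕ) (m : M) : P.φ (k • m) = P.φ m ^ k :=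
  P.hom.map_pow (Multiplicative.ofAdd m) k

theorem φ_pow_prime (m : M) : P.φ m ^ p = 1 := by
  rw [← P.map_nsmul, ← Nat.cast_smul_eq_nsmul (ZMod p), CharP.cast_eq_zero, zero_smul, P.map_zero]

theorem φ_mul_comm (m n : M) : P.φ m * P.φ n = P.φ n * P.φ m := by
  rw [← P.map_add, ← P.map_add, add_comm]

theorem σ_pow_mul (k : ℕ) (m : M) :
    P.σ ^ k * P.φ m = P.φ (((1 + D.op) ^ k) m) * P.σ ^ k := by
  induction k generalizing m with
  | zero => simp
  | succ k ih =>
    rw [pow_succ, mul_assoc, P.σ_mul, ← mul_assoc, ih, pow_succ (1 + D.op), Module.End.mul_apply,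
      mul_assoc]
    rfl

theorem mul_mul_mul (m n : M) (a b : ℕ) :
    (P.φ m * P.σ ^ a) * (P.φ n * P.σ ^ b) =
      P.φ (m + ((1 + D.op) ^ a) n) * P.σ ^ (a + b) := by
  rw [mul_assoc, ← mul_assoc (P.σ ^ a), P.σ_pow_mul, P.map_add, pow_add]
  simp only [mul_assoc]

theorem mul_pow_eq (m : M) (a k : ℕ) :
    (P.φ m * P.σ ^ a) ^ k =
      P.φ ((∑ j ∈ Finset.range k, ((1 + D.op) ^ a) ^ j) m) * P.σ ^ (a * k) := by
  induction k with
  | zero => simp [P.map_zero]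
  | succ k ih =>
    rw [pow_succ, ih, P.mul_mul_mul, Finset.sum_range_succ, LinearMap.add_apply, ← pow_mul,
      mul_add, mul_one]

/-- If the `p`-th power of the lift `σ` is `op ^ (p - 1)` of `y`, then `φ (-y) * σ` is a lift of
order `p`. -/
def splitting [Fact p.Prime] {D' : CyclicDatum p M} (hop : D'.op = D.op) (hz : D'.z = 0) (y : M)
    (hy : (D.op ^ (p - 1)) y = D.z) : Presentation D' T where
  φ := P.φ
  σ := P.φ (-y) * P.σ
  map_add := P.map_add
  continuous := P.continuous
  injective := P.injective
  σ_mul m := by rw [mul_assoc, P.σ_mul, ← mul_assoc, P.φ_mul_comm, hop, mul_assoc]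
  σ_pow := by
    have h := P.mul_pow_eq (-y) 1 p
    rw [pow_one, pow_one, geom_sum_one_add, one_mul, P.σ_pow, ← P.map_add, _root_.map_neg, hy,
      neg_add_cancel] at h
    rw [h, hz]
  φ_ne_σ m h := P.φ_ne_σ (y + m) (by rw [P.map_add, h, P.map_neg, mul_inv_cancel_left])
  exists_eq t := by
    obtain ⟨m, k, rfl⟩ := P.exists_eq t
    have h := P.mul_pow_eq (-y) 1 k
    rw [one_mul, pow_one] at h
    refine ⟨m - (∑ j ∈ Finset.range k, ((1 + D.op) ^ 1) ^ j : Module.End (ZMod p) M) (-y), k, ?_⟩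
    rw [h, ← mul_assoc, ← P.map_add, sub_add_cancel]

end Presentation

theorem isCoatom_of_isCoatom_comap {G H : Type*} [Group G] [Group H] {f : G →* H}
    (hf : Function.Surjective f) {K : Subgroup H} (hK : IsCoatom (K.comap f)) : IsCoatom K := by
  refine ⟨fun h => hK.1 (by rw [h, Subgroup.comap_top]), fun L hL => ?_⟩
  refine Subgroup.comap_injective hf ?_
  rw [hK.2 _ ((Subgroup.comap_lt_comap_of_surjective hf).mpr hL), Subgroup.comap_top]

theorem exists_eq_mul_pow_of_isCoatom {p : ℕ} (hp : p ≠ 0) {G : Type*} [Group G] {N : Subgroup G}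
    [N.Normal] (hN : IsCoatom N) {σ : G} (hσ : σ ∉ N) (hσp : σ ^ p ∈ N) (g : G) :
    ∃ n ∈ N, ∃ k : ℕ, g = n * σ ^ k := by
  have htop : N ⊔ Subgroup.zpowers σ = ⊤ := hN.2 _ <| left_lt_sup.mpr fun h =>
    hσ (h (Subgroup.mem_zpowers σ))
  obtain ⟨n, hn, _, ⟨i, rfl⟩, rfl⟩ :=
    Subgroup.mem_sup_of_normal_left.mp (htop ▸ Subgroup.mem_top g)
  refine ⟨n * (σ ^ p) ^ (i / p), N.mul_mem hn (N.zpow_mem hσp _), (i % p).toNat, ?_⟩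
  rw [mul_assoc, ← zpow_natCast σ (i % p).toNat,
    Int.toNat_of_nonneg (Int.emod_nonneg _ (Int.natCast_ne_zero.mpr hp)), ← zpow_natCast σ p,
    ← zpow_mul, ← zpow_add, Int.mul_ediv_add_emod]

section MaximalClosed

variable {p : ℕ} {T : Type v} [Group T] [TopologicalSpace T] [IsTopologicalGroup T]
  [CompactSpace T] [TotallyDisconnectedSpace T] {N : Subgroup T}

theorem isOpen_of_isMaximalClosed (hN : IsMaximalClosed N) : IsOpen (N : Set T) := by
  have hsInf : (⟨N, hN.prop.1⟩ : ClosedSubgroup T).toSubgroup = _ :=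
    ProfiniteGrp.closedSubgroup_eq_sInf_open _
  obtain ⟨H, hH, hNH, hne⟩ : ∃ H : Subgroup T, IsOpen (H : Set T) ∧ N ≤ H ∧ H ≠ ⊤ := by
    by_contra! h
    exact hN.prop.2 (hsInf.trans (sInf_eq_top.mpr fun H hH => h H hH.1 hH.2))
  rwa [hN.eq_of_le ⟨H.isClosed_of_isOpen hH, hne⟩ hNH]

theorem isCoatom_of_isMaximalClosed (hN : IsMaximalClosed N) : IsCoatom N := by
  refine ⟨hN.prop.2, fun H hH => ?_⟩
  by_contra hne
  have hopen : IsOpen (H : Set T) := Subgroup.isOpen_mono hH.le (isOpen_of_isMaximalClosed hN)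
  exact hH.not_ge (hN.le_of_ge ⟨H.isClosed_of_isOpen hopen, hne⟩ hH.le)

theorem normal_of_isMaximalClosed [Fact p.Prime]
    (hT : ∀ U : OpenNormalSubgroup T, IsPGroup p (T ⧸ U.toSubgroup)) (hN : IsMaximalClosed N) :
    N.Normal := by
  obtain ⟨U, hUN : U.toSubgroup ≤ N⟩ := ProfiniteGrp.exist_openNormalSubgroup_sub_open_nhds_of_one
    (isOpen_of_isMaximalClosed hN) N.one_mem
  have : Finite (T ⧸ U.toSubgroup) := Subgroup.quotient_finite_of_isOpen _ U.isOpen'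
  have : Group.IsNilpotent (T ⧸ U.toSubgroup) := (hT U).isNilpotent
  have hcomap : (N.map (QuotientGroup.mk' U.toSubgroup)).comap (QuotientGroup.mk' _) = N :=
    Subgroup.comap_map_eq_self (by rwa [QuotientGroup.ker_mk'])
  have hcoatom : IsCoatom (N.map (QuotientGroup.mk' U.toSubgroup)) := by
    refine isCoatom_of_isCoatom_comap (QuotientGroup.mk'_surjective _) ?_
    rw [hcomap]
    exact isCoatom_of_isMaximalClosed hN
  have hnormal := Subgroup.NormalizerCondition.normal_of_coatom _
    Group.normalizerCondition_of_isNilpotent hcoatom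
  rw [← hcomap]
  exact hnormal.comap _

theorem exists_notMem_pow_mem (hT : ∀ U : OpenNormalSubgroup T, IsPGroup p (T ⧸ U.toSubgroup))
    (hN : IsMaximalClosed N) : ∃ σ, σ ∉ N ∧ σ ^ p ∈ N := by
  classical
  obtain ⟨U, hUN⟩ := ProfiniteGrp.exist_openNormalSubgroup_sub_open_nhds_of_one
    (isOpen_of_isMaximalClosed hN) N.one_mem
  obtain ⟨s, -, hs⟩ := SetLike.exists_of_lt hN.prop.2.lt_top
  have hex : ∃ k, s ^ p ^ k ∈ N := by
    obtain ⟨k, hk⟩ := hT U (QuotientGroup.mk s)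
    rw [← QuotientGroup.mk_pow, QuotientGroup.eq_one_iff] at hk
    exact ⟨k, hUN hk⟩
  obtain ⟨k, hk⟩ : ∃ k, Nat.find hex = k + 1 :=
    Nat.exists_eq_succ_of_ne_zero fun h => hs (by simpa [h] using Nat.find_spec hex)
  refine ⟨s ^ p ^ k, Nat.find_min hex (by omega), ?_⟩
  rw [← pow_mul, ← pow_succ, ← hk]
  exact Nat.find_spec hex

end MaximalClosed

section Conjugation

open scoped IsMulCommutative

variable {p : ℕ} {G : Type*} [Group G] {N : Subgroup G} [N.Normal] [IsMulCommutative N]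
  [Module (ZMod p) (Additive N)]

variable (p N) in
/-- Conjugation by `σ` on an elementary abelian normal subgroup. -/
def conjEnd (σ : G) : Module.End (ZMod p) (Additive N) :=
  (MonoidHom.toAdditive (MulAut.conjNormal σ : N ≃* N).toMonoidHom).toZModLinearMap p

theorem conjEnd_apply (σ : G) (m : Additive N) :
    ((conjEnd p N σ m).toMul : G) = σ * m.toMul * σ⁻¹ :=
  MulAut.conjNormal_apply σ m.toMul

theorem conjEnd_pow_apply (σ : G) (k : ℕ) (m : Additive N) :
    ((conjEnd p N σ ^ k) m).toMul = σ ^ k * (m.toMul : G) * (σ ^ k)⁻¹ := by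
  induction k with
  | zero => simp
  | succ k ih =>
    rw [pow_succ', Module.End.mul_apply, conjEnd_apply, ih, pow_succ']
    group

theorem conjEnd_pow_prime_eq_one {σ : G} (hσp : σ ^ p ∈ N) : conjEnd p N σ ^ p = 1 := by
  ext m
  have hcomm : σ ^ p * (m.toMul : G) = m.toMul * σ ^ p :=
    congrArg Subtype.val (mul_comm (⟨σ ^ p, hσp⟩ : N) m.toMul)
  rw [conjEnd_pow_apply, hcomm, mul_inv_cancel_right]
  rfl

end Conjugation

section KernelDatum

open scoped IsMulCommutative

variable {p : ℕ} {T : Type v} [Group T] [TopologicalSpace T] [IsTopologicalGroup T]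
  {N : Subgroup T} [N.Normal] [IsMulCommutative N] [Module (ZMod p) (Additive N)]

theorem continuous_conjEnd (σ : T) : Continuous (conjEnd p N σ) := by
  refine continuous_ofMul.comp (continuous_induced_rng.mpr ?_)
  exact (show Continuous fun n : N => σ * (n : T) * σ⁻¹ by fun_prop).comp continuous_toMul

variable [Fact p.Prime]

/-- The datum on an elementary abelian normal subgroup `N` determined by an element `σ` with
`σ ^ p ∈ N`. -/
def kernelDatum {σ : T} (hσp : σ ^ p ∈ N) : CyclicDatum p (Additive N) where
  op := conjEnd p N σ - 1
  op_pow := by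
    have h := one_add_pow_prime (p := p) (conjEnd p N σ - 1)
    rw [add_sub_cancel, conjEnd_pow_prime_eq_one hσp] at h
    exact left_eq_add.mp h
  continuous_op := (continuous_conjEnd σ).sub continuous_id
  z := Additive.ofMul ⟨σ ^ p, hσp⟩
  op_z := by
    rw [LinearMap.sub_apply, sub_eq_zero]
    refine congrArg Additive.ofMul (Subtype.ext ((conjEnd_apply (p := p) _ _).trans ?_))
    change σ * σ ^ p * σ⁻¹ = σ ^ p
    rw [← pow_succ', pow_succ, mul_inv_cancel_right]

/-- A group with an elementary abelian normal coatom is an extension of `ℤ/p`. -/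
def kernelPresentation (hN : IsCoatom N) {σ : T} (hσ : σ ∉ N) (hσp : σ ^ p ∈ N) :
    Presentation (kernelDatum hσp) T where
  φ m := m.toMul
  σ := σ
  map_add _ _ := rfl
  continuous := continuous_subtype_val.comp continuous_toMul
  injective _ _ h := congrArg Additive.ofMul (Subtype.ext h)
  σ_mul m := by
    have h : m + (kernelDatum hσp).op m = conjEnd p N σ m := add_sub_cancel m _
    rw [h, conjEnd_apply, inv_mul_cancel_right]
  σ_pow := rfl
  φ_ne_σ m h := hσ (h ▸ m.toMul.2)
  exists_eq t := by
    obtain ⟨n, hn, k, rfl⟩ :=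
      exists_eq_mul_pow_of_isCoatom (Fact.out : p.Prime).ne_zero hN hσ hσp t
    exact ⟨Additive.ofMul ⟨n, hn⟩, k, rfl⟩

end KernelDatum

namespace JordanType

variable {p : ℕ} (J : JordanType.{v} p)

/-- The datum on the coordinate space given by the shift and by a vector `z` that it kills. -/
def datum {z : J.space (ZMod p)} (hz : J.shift (ZMod p) z = 0) :
    CyclicDatum p (J.space (ZMod p)) where
  op := J.shift (ZMod p)
  op_pow := J.shift_pow_eq_zero (ZMod p)
  continuous_op := continuous_shift
  z := z
  op_z := hz

/-- The datum of the split extension with Jordan type `J`. -/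
def splitDatum : CyclicDatum p (J.space (ZMod p)) :=
  J.datum (map_zero _)

/-- The datum of the extension with Jordan type `J` in which `σ ^ p` spans the kernel of the shift
on the block `b₀`. -/
noncomputable def nonsplitDatum (b₀ : J.Index) : CyclicDatum p (J.space (ZMod p)) :=
  J.datum (shift_unitVec b₀)

end JordanType

theorem exists_jordan_presentation {p : ℕ} [Fact p.Prime] {M : Type v} [AddCommGroup M]
    [Module (ZMod p) M] [TopologicalSpace M] [CompactSpace M] [IsTopologicalAddGroup M]
    [TotallyDisconnectedSpace M] {D : CyclicDatum p M} {T : Type v} [Group T] [TopologicalSpace T]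
    (P : Presentation D T) :
    ∃ J : JordanType.{v} p, Nonempty (Presentation J.splitDatum T) ∨
      ∃ b₀, J.len b₀ < p ∧ Nonempty (Presentation (J.nonsplitDatum b₀) T) := by
  obtain ⟨J, e, he, h⟩ := exists_equiv_space_of_apply_eq_zero D.continuous_op D.op_pow D.op_z
  have hsymm : ∀ m, D.op (e.symm m) = e.symm (J.shift (ZMod p) m) := fun m =>
    e.injective (by rw [he, e.apply_symm_apply, e.apply_symm_apply])
  refine ⟨J, ?_⟩
  rcases h with ⟨b₀, hb₀, hz⟩ | ⟨y, hy⟩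
  · exact Or.inr ⟨b₀, hb₀, ⟨P.comp (D' := J.nonsplitDatum b₀) e.symm.toLinearEquiv
      e.symm.continuous hsymm (e.symm_apply_eq.mpr hz.symm)⟩⟩
  · let D₀ : CyclicDatum p M := { D with z := 0, op_z := map_zero _ }
    exact Or.inl ⟨(P.splitting (D' := D₀) rfl rfl y hy).comp (D' := J.splitDatum)
      e.symm.toLinearEquiv e.symm.continuous hsymm (map_zero _)⟩

open scoped IsMulCommutative in
theorem exists_jordan_presentation_of_isTGroup {p : ℕ} [Fact p.Prime] {T : ProfiniteGrp.{v}}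
    (hT : IsTGroup p T) :
    ∃ J : JordanType.{v} p, Nonempty (Presentation J.splitDatum T) ∨
      ∃ b₀, J.len b₀ < p ∧ Nonempty (Presentation (J.nonsplitDatum b₀) T) := by
  obtain ⟨N, hN, hcomm, hexp⟩ := hT.exists_maximal
  have : N.Normal := normal_of_isMaximalClosed hT.proP hN
  obtain ⟨σ, hσ, hσp⟩ := exists_notMem_pow_mem hT.proP hN
  have : IsMulCommutative N := ⟨⟨fun a b => Subtype.ext (hcomm a a.2 b b.2)⟩⟩
  let _ : Module (ZMod p) (Additive N) := AddCommGroup.zmodModule fun m : Additive N =>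
    congrArg Additive.ofMul (Subtype.ext (hexp m.toMul m.toMul.2) : m.toMul ^ p = 1)
  have : CompactSpace (Additive N) := isCompact_iff_compactSpace.mp hN.prop.1.isCompact
  have : TotallyDisconnectedSpace (Additive N) := inferInstanceAs (TotallyDisconnectedSpace N)
  exact exists_jordan_presentation
    (kernelPresentation (isCoatom_of_isMaximalClosed hN) hσ hσp)

theorem exists_continuousMulEquiv_of_isQuotientMap {G H K : Type*} [Group G] [Group H] [Group K]
    [TopologicalSpace G] [TopologicalSpace H] [TopologicalSpace K] {q : G →* H} {r : G →* K}
    (hq : Topology.IsQuotientMap q) (hr : Topology.IsQuotientMap r) (hker : q.ker = r.ker) :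
    Nonempty (H ≃ₜ* K) := by
  let e : H ≃* K := (QuotientGroup.quotientKerEquivOfSurjective q hq.surjective).symm.trans
    ((QuotientGroup.quotientMulEquivOfEq hker).trans
      (QuotientGroup.quotientKerEquivOfSurjective r hr.surjective))
  have he : ∀ g, e (q g) = r g := fun g => by
    have hg : (QuotientGroup.quotientKerEquivOfSurjective q hq.surjective).symm (q g) = g :=
      (MulEquiv.symm_apply_eq _).mpr rfl
    simp only [e, MulEquiv.trans_apply, hg]
    rfl
  refine ⟨{ e with
    continuous_toFun := hq.continuous_iff.mpr (hr.continuous.congr fun g => (he g).symm)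
    continuous_invFun := hr.continuous_iff.mpr (hq.continuous.congr fun g => ?_) }⟩
  exact (e.symm_apply_eq.mpr (he g).symm).symm

theorem dimH1_eq {p : ℕ} [Fact p.Prime] {T : Type v} [Group T] [TopologicalSpace T] [T2Space T]
    {B : Type*} [AddGroup B] [TopologicalSpace B] [CompactSpace B]
    {A K : Subgroup T} {f : B → T} (hf : Continuous f) (hadd : ∀ x y, f (x + y) = f x * f y)
    (hrange : Set.range f = A) {I : Type v} {π : B →+ I → ZMod p} (hπ : Continuous π)
    (hsurj : Function.Surjective π) (hker : ∀ x, π x = 0 ↔ f x ∈ Subgroup.center T ⊓ K) :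
    dimH1 p T A K = Cardinal.mk I := by
  have hmem : ∀ x, f x ∈ A := fun x => by
    rw [← SetLike.mem_coe, ← hrange]
    exact Set.mem_range_self x
  let f' : Multiplicative B →* A :=
    MonoidHom.mk' (fun x => ⟨f x.toAdd, hmem _⟩) fun x y => Subtype.ext (hadd _ _)
  let q := (QuotientGroup.mk' ((Subgroup.center T ⊓ K).subgroupOf A)).comp f'
  have hf'c : Continuous f' := (hf.comp continuous_toAdd).subtype_mk _
  have hf's : Function.Surjective f' := fun ⟨t, ht⟩ => by
    obtain ⟨x, rfl⟩ : t ∈ Set.range f := hrange ▸ ht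
    exact ⟨Multiplicative.ofAdd x, rfl⟩
  have hq : Topology.IsQuotientMap q :=
    (QuotientGroup.isQuotientMap_mk _).comp (hf'c.isClosedMap.isQuotientMap hf'c hf's)
  have hπ' : Continuous (AddMonoidHom.toMultiplicative π) :=
    continuous_ofAdd.comp (hπ.comp continuous_toAdd)
  have hr : Topology.IsQuotientMap (AddMonoidHom.toMultiplicative π) :=
    hπ'.isClosedMap.isQuotientMap hπ' (Multiplicative.ofAdd.surjective.comp
      (hsurj.comp Multiplicative.toAdd.surjective))
  have hkernel : q.ker = (AddMonoidHom.toMultiplicative π).ker := by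
    ext x
    refine (QuotientGroup.eq_one_iff (f' x)).trans ((hker x.toAdd).symm.trans ?_)
    exact Multiplicative.ofAdd.injective.eq_iff.symm
  obtain ⟨e⟩ := exists_continuousMulEquiv_of_isQuotientMap hq hr hkernel
  exact rank_H1_eq e

theorem one_add_pow_sub_mem_range {R M : Type*} [Ring R] [AddCommGroup M] [Module R M]
    (x : Module.End R M) (a : ℕ) {k : ℕ} {m : M} (hm : m ∈ LinearMap.range (x ^ k)) :
    ((1 + x) ^ a) m - m ∈ LinearMap.range (x ^ (k + 1)) := by
  obtain ⟨q, hq, h⟩ := exists_one_add_pow_eq x a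
  obtain ⟨y, rfl⟩ := hm
  refine ⟨q y, ?_⟩
  rw [h, LinearMap.add_apply, Module.End.one_apply, add_sub_cancel_left, ← Module.End.mul_apply,
    ← Module.End.mul_apply, pow_succ', mul_assoc, mul_assoc, (hq.pow_left k).eq]

theorem isClosed_range_pow {R M : Type*} [Semiring R] [AddCommMonoid M] [Module R M]
    [TopologicalSpace M] [CompactSpace M] [T2Space M] {x : Module.End R M} (hx : Continuous x)
    (k : ℕ) : IsClosed (LinearMap.range (x ^ k) : Set M) :=
  (isCompact_range (continuous_end_pow hx k)).isClosed

/-- The action and the power element of `D` are trivial, that is, the groups described by `D` are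
elementary abelian. -/
def CyclicDatum.IsTrivial {p : ℕ} {M : Type v} [AddCommGroup M] [Module (ZMod p) M]
    [TopologicalSpace M] (D : CyclicDatum p M) : Prop :=
  D.op = 0 ∧ D.z = 0

namespace Presentation

open scoped commutatorElement

variable {p : ℕ} {M : Type v} [AddCommGroup M] [Module (ZMod p) M] [TopologicalSpace M]
  {D : CyclicDatum p M} {T : Type v} [Group T] [TopologicalSpace T] (P : Presentation D T)

/-- The image in `T` of a subspace of the kernel. -/
def image (S : Submodule (ZMod p) M) : Subgroup T :=
  (AddSubgroup.toSubgroup S.toAddSubgroup).map P.hom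

theorem mem_image {S : Submodule (ZMod p) M} {t : T} : t ∈ P.image S ↔ ∃ m ∈ S, P.φ m = t :=
  Iff.rfl

theorem φ_mem_image {S : Submodule (ZMod p) M} {m : M} : P.φ m ∈ P.image S ↔ m ∈ S :=
  P.injective.mem_set_image

theorem isClosed_image [CompactSpace M] [T2Space T] {S : Submodule (ZMod p) M}
    (hS : IsClosed (S : Set M)) : IsClosed (P.image S : Set T) :=
  (hS.isCompact.image P.continuous).isClosed

theorem commutator_eq (m n : M) (a b : ℕ) :
    ⁅P.φ m * P.σ ^ a, P.φ n * P.σ ^ b⁆ =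
      P.φ ((((1 + D.op) ^ a) n - n) - (((1 + D.op) ^ b) m - m)) := by
  have h : ∀ g h : T, ⁅g, h⁆ = (g * h) * (h * g)⁻¹ := fun g h => by
    rw [commutatorElement_def, mul_inv_rev, mul_assoc (g * h)]
  rw [h, P.mul_mul_mul, P.mul_mul_mul, add_comm b a, mul_inv_rev, ← mul_assoc,
    mul_inv_cancel_right, ← P.map_neg, ← P.map_add]
  congr 1
  abel

theorem commutator_φ (m n : M) (b : ℕ) :
    ⁅P.φ m, P.φ n * P.σ ^ b⁆ = P.φ (-(((1 + D.op) ^ b) m - m)) := by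
  simpa using P.commutator_eq m n 0 b

theorem commutator_φ_σ (m : M) : ⁅P.φ m, P.σ⁆ = P.φ (-D.op m) := by
  simpa [P.map_zero] using P.commutator_φ m 0 1

theorem φ_mem_center_iff {m : M} : P.φ m ∈ Subgroup.center T ↔ D.op m = 0 := by
  rw [Subgroup.mem_center_iff]
  constructor
  · intro h
    have hσ := h P.σ
    rw [P.σ_mul] at hσ
    simpa using P.injective (mul_right_cancel hσ)
  · intro h t
    obtain ⟨n, k, rfl⟩ := P.exists_eq t
    have hk : ((1 + D.op) ^ k) m = m := by
      rw [Module.End.pow_apply]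
      exact Function.iterate_fixed (by simp [h]) k
    rw [mul_assoc, P.σ_pow_mul, hk, ← mul_assoc, P.φ_mul_comm, mul_assoc]

section Prime

variable [Fact p.Prime]

theorem exists_pow_prime_eq (m : M) (a : ℕ) :
    ∃ n ∈ LinearMap.range (D.op ^ (p - 1)), (P.φ m * P.σ ^ a) ^ p = P.φ (n + a • D.z) := by
  obtain ⟨q, hq⟩ := exists_geom_sum_one_add_pow_eq (p := p) D.op a
  refine ⟨_, ⟨q m, rfl⟩, ?_⟩
  rw [P.mul_pow_eq, mul_comm a p, pow_mul, P.σ_pow, hq, P.map_add, P.map_nsmul]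
  rfl

theorem op_eq_zero_of_mul_σ_pow_mem_center {m : M} {k : ℕ} (hk : ¬p ∣ k)
    (h : P.φ m * P.σ ^ k ∈ Subgroup.center T) : D.op = 0 := by
  have hpow : (1 + D.op) ^ k = 1 := by
    ext n
    have hn := commutatorElement_eq_one_iff_mul_comm.mpr (Subgroup.mem_center_iff.mp h (P.φ n))
    rw [P.commutator_φ, ← P.map_zero] at hn
    exact sub_eq_zero.mp (neg_eq_zero.mp (P.injective hn))
  have hprime : (1 + D.op) ^ p = 1 := by rw [one_add_pow_prime, D.op_pow, add_zero]
  have hgcd := pow_gcd_eq_one.mpr ⟨hpow, hprime⟩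
  rwa [((Fact.out : p.Prime).coprime_iff_not_dvd.mpr hk).symm, pow_one, add_eq_left] at hgcd

theorem z_eq_zero_of_mul_σ_pow_pow_eq_one (hop : D.op = 0) {m : M} {k : ℕ} (hk : ¬p ∣ k)
    (h : (P.φ m * P.σ ^ k) ^ p = 1) : D.z = 0 := by
  obtain ⟨n, ⟨y, rfl⟩, hn⟩ := P.exists_pow_prime_eq m k
  have hp := (Fact.out : p.Prime).two_le
  rw [h, hop, zero_pow (by omega), LinearMap.zero_apply, zero_add, ← P.map_zero] at hn
  have hz : (k : ZMod p) • D.z = 0 := by rw [Nat.cast_smul_eq_nsmul, P.injective hn]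
  exact (smul_eq_zero.mp hz).resolve_left fun h0 => hk ((ZMod.natCast_eq_zero_iff k p).mp h0)

theorem centerTorsion_eq (hD : ¬D.IsTrivial) :
    centerTorsion p T = P.image (LinearMap.ker D.op) := by
  ext t
  constructor
  · rintro ⟨hc, ht⟩
    obtain ⟨m, k, rfl⟩ := P.exists_eq t
    have hk : p ∣ k := by
      by_contra hk
      have hop := P.op_eq_zero_of_mul_σ_pow_mem_center hk hc
      exact hD ⟨hop, P.z_eq_zero_of_mul_σ_pow_pow_eq_one hop hk ht⟩
    obtain ⟨d, rfl⟩ := hk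
    rw [pow_mul, P.σ_pow, ← P.map_nsmul, ← P.map_add] at hc ⊢
    exact P.φ_mem_image.mpr (P.φ_mem_center_iff.mp hc)
  · rintro ⟨m, hm, rfl⟩
    exact ⟨P.φ_mem_center_iff.mpr hm, P.φ_pow_prime m⟩

end Prime

section CentralSeries

variable [IsTopologicalGroup T] [T2Space T] [CompactSpace M] [T2Space M]

theorem topologicalClosure_commutator_eq {H : Subgroup T} {k : ℕ}
    (hle : P.image (LinearMap.range (D.op ^ k)) ≤ H)
    (hcomm : ⁅H, ⊤⁆ ≤ P.image (LinearMap.range (D.op ^ (k + 1)))) :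
    ⁅H, (⊤ : Subgroup T)⁆.topologicalClosure = P.image (LinearMap.range (D.op ^ (k + 1))) := by
  refine le_antisymm (Subgroup.topologicalClosure_minimal _ hcomm
    (P.isClosed_image (isClosed_range_pow D.continuous_op _))) ?_
  rintro _ ⟨_, ⟨m, rfl⟩, rfl⟩
  have hm : ⁅P.φ ((D.op ^ k) (-m)), P.σ⁆ = P.φ ((D.op ^ (k + 1)) m) := by
    rw [P.commutator_φ_σ, _root_.map_neg, _root_.map_neg, neg_neg, pow_succ']
    rfl
  have hmem := Subgroup.commutator_mem_commutator
    (hle (P.φ_mem_image.mpr ⟨-m, rfl⟩)) (Subgroup.mem_top P.σ)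
  rw [hm] at hmem
  exact Subgroup.le_topologicalClosure _ hmem

theorem centralSeries_eq (k : ℕ) :
    centralSeries T (k + 2) = P.image (LinearMap.range (D.op ^ (k + 1))) := by
  induction k with
  | zero =>
    refine P.topologicalClosure_commutator_eq le_top (Subgroup.commutator_le.mpr ?_)
    intro g _ h _
    obtain ⟨m, a, rfl⟩ := P.exists_eq g
    obtain ⟨n, b, rfl⟩ := P.exists_eq h
    rw [P.commutator_eq, P.φ_mem_image]
    exact sub_mem (one_add_pow_sub_mem_range _ _ ⟨n, rfl⟩) (one_add_pow_sub_mem_range _ _ ⟨m, rfl⟩)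
  | succ k ih =>
    refine P.topologicalClosure_commutator_eq ih.ge (Subgroup.commutator_le.mpr ?_)
    rw [show centralSeries T (k + 1 + 1) = _ from ih]
    rintro _ ⟨m, hm, rfl⟩ h _
    obtain ⟨n, b, rfl⟩ := P.exists_eq h
    rw [show ⁅P.hom m, P.φ n * P.σ ^ b⁆ = _ from P.commutator_φ m.toAdd n b, P.φ_mem_image]
    exact neg_mem (one_add_pow_sub_mem_range _ _ hm)

theorem center_inf_centralSeries (k : ℕ) :
    Subgroup.center T ⊓ centralSeries T (k + 2) =
      P.image (socle D.op (k + 1)) := by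
  rw [P.centralSeries_eq]
  ext t
  constructor
  · rintro ⟨hc, m, hm, rfl⟩
    exact ⟨m, ⟨P.φ_mem_center_iff.mp hc, hm⟩, rfl⟩
  · rintro ⟨m, ⟨hc, hm⟩, rfl⟩
    exact ⟨P.φ_mem_center_iff.mpr hc, m, hm, rfl⟩

include P in
theorem powerSubgroup_le_iff [Fact p.Prime] {k : ℕ} (hk : k + 2 ≤ p) :
    powerSubgroup p T ≤ centralSeries T (k + 2) ↔ D.z ∈ LinearMap.range (D.op ^ (k + 1)) := by
  rw [P.centralSeries_eq]
  constructor
  · intro h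
    rw [← P.φ_mem_image, ← P.σ_pow]
    exact h (Subgroup.le_topologicalClosure _ (Subgroup.subset_closure ⟨P.σ, rfl⟩))
  · intro h
    refine Subgroup.topologicalClosure_minimal _ ((Subgroup.closure_le _).mpr ?_)
      (P.isClosed_image (isClosed_range_pow D.continuous_op _))
    rintro _ ⟨t, rfl⟩
    obtain ⟨m, a, rfl⟩ := P.exists_eq t
    obtain ⟨n, hn, hpow⟩ := P.exists_pow_prime_eq m a
    have hn' : n ∈ LinearMap.range (D.op ^ (k + 1)) :=
      (LinearMap.iterateRange D.op).monotone (by omega : k + 1 ≤ p - 1) hn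
    rw [SetLike.mem_coe, show (fun x => x ^ p) _ = _ from hpow, P.φ_mem_image]
    exact add_mem hn' (Submodule.smul_of_tower_mem _ a h)

end CentralSeries

theorem dimH1_eq_of_image [Fact p.Prime] [T2Space T] [CompactSpace M]
    {A K : Subgroup T} {S S' : Submodule (ZMod p) M} (hS : IsClosed (S : Set M))
    (hA : A = P.image S) (hK : Subgroup.center T ⊓ K = P.image S')
    {I : Type v} (π : S →+ I → ZMod p) (hπ : Continuous π) (hsurj : Function.Surjective π)
    (hker : ∀ s, π s = 0 ↔ s.1 ∈ S') : dimH1 p T A K = Cardinal.mk I := by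
  have : CompactSpace S := isCompact_iff_compactSpace.mp hS.isCompact
  refine dimH1_eq (f := fun s : S => P.φ s) (P.continuous.comp continuous_subtype_val)
    (fun s s' => P.map_add s s') ?_ hπ hsurj fun s => ?_
  · ext t
    rw [hA, SetLike.mem_coe, P.mem_image]
    simp
  · rw [hK, P.φ_mem_image, hker]

end Presentation

section Carry

variable {p : ℕ}

/-- The carry in the addition of two digits in base `p`. As a function of two elements of `ℤ/p` it
is a `2`-cocycle, the class of the extension `ℤ/p²` of `ℤ/p` by `ℤ/p`. -/
def carry (a b : ZMod p) : ℕ :=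
  (a.val + b.val) / p

variable [NeZero p]

theorem val_add_add_mul_carry (a b : ZMod p) : (a + b).val + p * carry a b = a.val + b.val := by
  rw [ZMod.val_add, carry, Nat.mod_add_div]

theorem carry_add_carry (a b c : ZMod p) :
    carry a b + carry (a + b) c = carry a (b + c) + carry b c := by
  refine Nat.eq_of_mul_eq_mul_left (NeZero.pos p) ?_
  have hab := val_add_add_mul_carry a b
  have hab_c := val_add_add_mul_carry (a + b) c
  have hbc := val_add_add_mul_carry b c
  have ha_bc := val_add_add_mul_carry a (b + c)
  rw [← add_assoc] at ha_bc
  linarith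

theorem zero_carry (a : ZMod p) : carry 0 a = 0 := by
  rw [carry, ZMod.val_zero, zero_add, Nat.div_eq_of_lt a.val_lt]

end Carry

namespace CyclicDatum

variable {p : ℕ} {M : Type v} [AddCommGroup M] [Module (ZMod p) M] [TopologicalSpace M]

theorem one_add_op_pow_z (D : CyclicDatum p M) (k : ℕ) : ((1 + D.op) ^ k) D.z = D.z := by
  rw [Module.End.pow_apply]
  exact Function.iterate_fixed (by simp [D.op_z]) k

/-- The extension of `ℤ/p` by `M` described by `D`; the pair `(m, a)` stands for the normal form
`φ m * σ ^ a.val`. -/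
def Extension (_ : CyclicDatum p M) : Type v := M × ZMod p

namespace Extension

variable {D : CyclicDatum p M}

instance : TopologicalSpace D.Extension := inferInstanceAs (TopologicalSpace (M × ZMod p))

instance [NeZero p] [CompactSpace M] : CompactSpace D.Extension :=
  inferInstanceAs (CompactSpace (M × ZMod p))

instance [TotallyDisconnectedSpace M] : TotallyDisconnectedSpace D.Extension :=
  inferInstanceAs (TotallyDisconnectedSpace (M × ZMod p))

/-- The element of the extension with the given normal form. -/
def mk (D : CyclicDatum p M) (m : M) (a : ZMod p) : D.Extension := (m, a)

instance : One D.Extension := ⟨mk D 0 0⟩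

instance : Mul D.Extension :=
  ⟨fun x y => mk D (x.1 + ((1 + D.op) ^ x.2.val) y.1 + carry x.2 y.2 • D.z) (x.2 + y.2)⟩

instance : Inv D.Extension :=
  ⟨fun x => mk D (-(((1 + D.op) ^ (-x.2).val) x.1 + carry (-x.2) x.2 • D.z)) (-x.2)⟩

theorem mk_mul_mk (m n : M) (a b : ZMod p) :
    mk D m a * mk D n b = mk D (m + ((1 + D.op) ^ a.val) n + carry a b • D.z) (a + b) :=
  rfl

theorem mk_inv (m : M) (a : ZMod p) :
    (mk D m a)⁻¹ = mk D (-(((1 + D.op) ^ (-a).val) m + carry (-a) a • D.z)) (-a) :=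
  rfl

theorem continuous_one_add_op_pow_val [IsTopologicalAddGroup M] :
    Continuous fun y : ZMod p × M => ((1 + D.op) ^ y.1.val) y.2 :=
  continuous_prod_of_discrete_left.mpr fun a =>
    continuous_end_pow (continuous_id.add D.continuous_op) a.val

variable [Fact p.Prime]

theorem one_add_op_pow_val_add (a b : ZMod p) :
    (1 + D.op) ^ (a + b).val = (1 + D.op) ^ a.val * (1 + D.op) ^ b.val := by
  have hp : (1 + D.op) ^ p = 1 := by rw [one_add_pow_prime, D.op_pow, add_zero]
  rw [ZMod.val_add, ← pow_eq_pow_mod _ hp, pow_add]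

theorem mk_zero_mul_mk (m n : M) (a : ZMod p) : mk D m 0 * mk D n a = mk D (m + n) a := by
  rw [mk_mul_mk, zero_carry, zero_smul, add_zero, ZMod.val_zero, pow_zero, Module.End.one_apply,
    zero_add]

theorem mul_assoc (x y w : D.Extension) : x * y * w = x * (y * w) := by
  obtain ⟨l, a⟩ := x
  obtain ⟨m, b⟩ := y
  obtain ⟨n, c⟩ := w
  change mk D l a * mk D m b * mk D n c = mk D l a * (mk D m b * mk D n c)
  simp only [mk_mul_mk, map_add, map_nsmul, one_add_op_pow_z, one_add_op_pow_val_add,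
    Module.End.mul_apply, add_assoc]
  have hcarry : carry a b • D.z + carry (a + b) c • D.z =
      carry a (b + c) • D.z + carry b c • D.z := by
    rw [← add_smul, ← add_smul, carry_add_carry]
  congr 1
  linear_combination (norm := abel) hcarry

theorem one_mul (x : D.Extension) : 1 * x = x :=
  (mk_zero_mul_mk 0 x.1 x.2).trans (congrArg (mk D · x.2) (zero_add x.1))

theorem inv_mul_cancel (x : D.Extension) : x⁻¹ * x = 1 := by
  obtain ⟨m, a⟩ := x
  change (mk D m a)⁻¹ * mk D m a = mk D 0 0
  rw [mk_inv, mk_mul_mk, neg_add_cancel, add_assoc, neg_add_cancel]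

instance : Group D.Extension :=
  Group.ofLeftAxioms mul_assoc one_mul inv_mul_cancel

variable (D) in
theorem mk_zero_one_pow (k : ℕ) : mk D 0 1 ^ k = mk D ((k / p) • D.z) k := by
  have hp : 1 < p := (Fact.out : p.Prime).one_lt
  have : Fact (1 < p) := ⟨hp⟩
  induction k with
  | zero =>
    rw [pow_zero, Nat.zero_div, zero_smul, Nat.cast_zero]
    rfl
  | succ k ih =>
    have hcarry : k / p + carry (k : ZMod p) 1 = (k + 1) / p := by
      rw [carry, ZMod.val_natCast, ZMod.val_one, ← Nat.mul_add_div (zero_lt_one.trans hp),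
        ← add_assoc, Nat.div_add_mod]
    rw [pow_succ, ih, mk_mul_mk, map_zero, add_zero, ← add_smul, hcarry, Nat.cast_succ]

/-- The tautological presentation of the extension. -/
def presentation (D : CyclicDatum p M) : Presentation D D.Extension where
  φ m := mk D m 0
  σ := mk D 0 1
  map_add m n := (mk_zero_mul_mk m n 0).symm
  continuous := Continuous.prodMk_left (0 : ZMod p)
  injective := Prod.mk_left_injective (0 : ZMod p)
  σ_mul m := by
    have hp := (Fact.out : p.Prime).one_lt
    have : Fact (1 < p) := ⟨hp⟩
    simp [mk_mul_mk, ZMod.val_one, carry, Nat.div_eq_of_lt hp]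
  σ_pow := by
    rw [mk_zero_one_pow, Nat.div_self (NeZero.pos p), one_smul, CharP.cast_eq_zero]
  φ_ne_σ m h := zero_ne_one (congrArg Prod.snd h)
  exists_eq t := by
    refine ⟨t.1, t.2.val, ?_⟩
    rw [mk_zero_one_pow, mk_zero_mul_mk, Nat.div_eq_of_lt t.2.val_lt, zero_smul, add_zero,
      ZMod.natCast_zmod_val]
    rfl

instance [IsTopologicalAddGroup M] : IsTopologicalGroup D.Extension where
  continuous_mul := by
    have hop : Continuous fun y : (M × ZMod p) × (M × ZMod p) => ((1 + D.op) ^ y.1.2.val) y.2.1 :=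
      continuous_one_add_op_pow_val.comp
        ((continuous_snd.comp continuous_fst).prodMk (continuous_fst.comp continuous_snd))
    have hcarry : Continuous fun y : (M × ZMod p) × (M × ZMod p) => carry y.1.2 y.2.2 • D.z :=
      (continuous_of_discreteTopology (f := fun y : ZMod p × ZMod p => carry y.1 y.2 • D.z)).comp
        ((continuous_snd.comp continuous_fst).prodMk (continuous_snd.comp continuous_snd))
    exact (((continuous_fst.comp continuous_fst).add hop).add hcarry).prodMk
      ((continuous_snd.comp continuous_fst).add (continuous_snd.comp continuous_snd))
  continuous_inv := by
    have hop : Continuous fun y : M × ZMod p => ((1 + D.op) ^ (-y.2).val) y.1 :=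
      continuous_one_add_op_pow_val.comp (continuous_snd.neg.prodMk continuous_fst)
    have hcarry : Continuous fun y : M × ZMod p => carry (-y.2) y.2 • D.z :=
      (continuous_of_discreteTopology (f := fun a : ZMod p => carry (-a) a • D.z)).comp
        continuous_snd
    exact (hop.add hcarry).neg.prodMk continuous_snd.neg

end Extension

end CyclicDatum

theorem mem_of_pow_mem_of_coprime {G : Type*} [Group G] {K : Subgroup G} {g : G} {m n : ℕ}
    (hmn : m.Coprime n) (hm : g ^ m ∈ K) (hn : g ^ n ∈ K) : g ∈ K := by
  have hg : g = (g ^ m) ^ m.gcdA n * (g ^ n) ^ m.gcdB n := by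
    rw [← zpow_natCast, ← zpow_natCast, ← zpow_mul, ← zpow_mul, ← zpow_add, ← Nat.gcd_eq_gcd_ab,
      hmn.gcd_eq_one, Nat.cast_one, zpow_one]
  rw [hg]
  exact K.mul_mem (K.zpow_mem hm _) (K.zpow_mem hn _)

namespace Presentation

variable {p : ℕ} [Fact p.Prime] {M : Type v} [AddCommGroup M] [Module (ZMod p) M]
  [TopologicalSpace M] {D : CyclicDatum p M} {T : Type v} [Group T] [TopologicalSpace T]
  (P : Presentation D T)

theorem σ_pow_mem_image_top_iff {k : ℕ} : P.σ ^ k ∈ P.image ⊤ ↔ p ∣ k := by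
  have hσp : P.σ ^ p ∈ P.image ⊤ := ⟨D.z, trivial, P.σ_pow.symm⟩
  refine ⟨fun hk => not_not.mp fun hdvd => ?_, ?_⟩
  · have hcop := (Fact.out : p.Prime).coprime_iff_not_dvd.mpr hdvd
    obtain ⟨m, -, hm⟩ := mem_of_pow_mem_of_coprime hcop hσp hk
    exact P.φ_ne_σ _ hm
  · rintro ⟨d, rfl⟩
    rw [pow_mul]
    exact pow_mem hσp d

theorem isCoatom_image_top : IsCoatom (P.image ⊤) := by
  have hφ : ∀ m, P.φ m ∈ P.image ⊤ := fun m => P.φ_mem_image.mpr trivial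
  refine ⟨fun h => ?_, fun H hH => H.eq_top_iff'.mpr fun t => ?_⟩
  · have hσ : P.σ ^ 1 ∈ P.image ⊤ := h ▸ Subgroup.mem_top _
    exact (Fact.out : p.Prime).one_lt.not_ge
      (Nat.le_of_dvd one_pos (P.σ_pow_mem_image_top_iff.mp hσ))
  · obtain ⟨s, hs, hsN⟩ := SetLike.exists_of_lt hH
    obtain ⟨m, k, rfl⟩ := P.exists_eq s
    rw [Subgroup.mul_mem_cancel_left _ (hH.le (hφ m))] at hs
    rw [Subgroup.mul_mem_cancel_left _ (hφ m), P.σ_pow_mem_image_top_iff] at hsN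
    have hσ : P.σ ∈ H := mem_of_pow_mem_of_coprime
      ((Fact.out : p.Prime).coprime_iff_not_dvd.mpr hsN)
      (hH.le (P.σ_pow_mem_image_top_iff.mpr dvd_rfl)) hs
    obtain ⟨n, l, rfl⟩ := P.exists_eq t
    exact H.mul_mem (hH.le (hφ n)) (pow_mem hσ l)

theorem isTGroup [CompactSpace M] {T : ProfiniteGrp.{v}} (P : Presentation D T) :
    IsTGroup p T where
  nontrivial := ⟨⟨1, P.σ, P.map_zero ▸ P.φ_ne_σ 0⟩⟩
  proP U := by
    refine IsPGroup.to_quotient (fun t => ⟨2, ?_⟩) _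
    obtain ⟨m, a, rfl⟩ := P.exists_eq t
    obtain ⟨n, -, hn⟩ := P.exists_pow_prime_eq m a
    rw [pow_two, pow_mul, hn, P.φ_pow_prime]
  exists_maximal := by
    refine ⟨P.image ⊤, ⟨⟨P.isClosed_image isClosed_univ, P.isCoatom_image_top.1⟩, ?_⟩, ?_, ?_⟩
    · exact fun H hH hle => (P.isCoatom_image_top.le_iff_eq hH.2 |>.mp hle).le
    · rintro _ ⟨m, -, rfl⟩ _ ⟨n, -, rfl⟩
      exact P.φ_mul_comm _ _
    · rintro _ ⟨m, -, rfl⟩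
      exact P.φ_pow_prime _

/-- The comparison of `T` with the extension described by `D`, through normal forms. -/
def param : D.Extension →* T :=
  MonoidHom.mk' (fun x => P.φ x.1 * P.σ ^ x.2.val) fun x y => by
    have hσ : P.σ ^ (x.2.val + y.2.val) = P.φ (carry x.2 y.2 • D.z) * P.σ ^ (x.2 + y.2).val := by
      rw [← val_add_add_mul_carry, add_comm, pow_add, pow_mul, P.σ_pow, P.map_nsmul]
    rw [P.mul_mul_mul, hσ, ← mul_assoc, ← P.map_add]
    rfl

theorem param_mk (m : M) (a : ZMod p) : P.param (.mk D m a) = P.φ m * P.σ ^ a.val :=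
  rfl

theorem param_mk_mem_image {S : Submodule (ZMod p) M} {m : M} {a : ZMod p} :
    P.param (.mk D m a) ∈ P.image S ↔ m ∈ S ∧ a = 0 := by
  constructor
  · rintro ⟨n, hn, hφσ : P.φ n = P.φ m * P.σ ^ a.val⟩
    have hσ : P.σ ^ a.val ∈ P.image ⊤ := by
      rw [← Subgroup.mul_mem_cancel_left _ (P.φ_mem_image.mpr (trivial : m ∈ ⊤)), ← hφσ]
      exact P.φ_mem_image.mpr trivial
    rw [P.σ_pow_mem_image_top_iff, ← ZMod.natCast_eq_zero_iff, ZMod.natCast_zmod_val] at hσ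
    rw [hσ, ZMod.val_zero, pow_zero, mul_one] at hφσ
    exact ⟨P.injective hφσ ▸ hn, hσ⟩
  · rintro ⟨hm, rfl⟩
    rw [P.param_mk, ZMod.val_zero, pow_zero, mul_one]
    exact P.φ_mem_image.mpr hm

theorem continuous_param [IsTopologicalGroup T] : Continuous P.param :=
  (P.continuous.comp continuous_fst).mul
    ((continuous_of_discreteTopology (f := fun a : ZMod p => P.σ ^ a.val)).comp continuous_snd)

theorem bijective_param : Function.Bijective P.param := by
  refine ⟨(injective_iff_map_eq_one _).mpr fun ⟨m, a⟩ h => ?_, fun t => ?_⟩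
  · obtain ⟨hm, ha⟩ := (P.param_mk_mem_image (S := ⊥)).mp
      (show P.param (.mk D m a) ∈ P.image ⊥ from h ▸ one_mem _)
    exact Prod.ext hm ha
  · obtain ⟨m, k, rfl⟩ := P.exists_eq t
    refine ⟨.mk D (m + (k / p) • D.z) k, ?_⟩
    rw [P.param_mk, P.map_add, P.map_nsmul, ← P.σ_pow, ← pow_mul, mul_assoc, ← pow_add,
      ZMod.val_natCast, Nat.div_add_mod]

variable [IsTopologicalGroup T] [T2Space T] [CompactSpace M]

/-- The group described by a datum is unique. -/
noncomputable def extensionEquiv : D.Extension ≃ₜ* T :=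
  ContinuousMulEquiv.mk' (P.continuous_param.homeoOfEquivCompactToT2
    (f := Equiv.ofBijective P.param P.bijective_param)) P.param.map_mul

include P in
theorem nonempty_continuousMulEquiv {T' : Type v} [Group T'] [TopologicalSpace T']
    [IsTopologicalGroup T'] [T2Space T'] (P' : Presentation D T') : Nonempty (T ≃ₜ* T') :=
  ⟨P.extensionEquiv.symm.trans P'.extensionEquiv⟩

end Presentation

namespace JordanType

/-- The number of blocks of size `i`. -/
def mult {n : ℕ} (J : JordanType.{v} n) (i : ℕ) : Cardinal.{v} :=
  Cardinal.mk {b // J.len b = i}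

variable {n : ℕ} {J : JordanType.{v} n}

theorem mult_eq_zero_iff {i : ℕ} : J.mult i = 0 ↔ ∀ b, J.len b ≠ i := by
  rw [mult, Cardinal.mk_eq_zero_iff, isEmpty_subtype]

theorem one_le_mult_len (b : J.Index) : 1 ≤ J.mult (J.len b) :=
  Cardinal.one_le_iff_ne_zero.mpr fun h => mult_eq_zero_iff.mp h b rfl

theorem forall_len_eq_one_iff :
    (∀ b, J.len b = 1) ↔ ∀ i, 2 ≤ i → i ≤ n → J.mult i = 0 := by
  refine ⟨fun h i hi _ => mult_eq_zero_iff.mpr fun b => ?_, fun h b => ?_⟩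
  · rw [h b]
    omega
  · by_contra hb
    exact mult_eq_zero_iff.mp
      (h (J.len b) (by have := J.one_le_len b; omega) (J.len_le b)) b rfl

variable {K : Type*} [Semiring K]

theorem unitVec_mem_range_shift_pow_iff [Nontrivial K] {b₀ : J.Index} {k : ℕ} :
    J.unitVec K b₀ ∈ LinearMap.range (J.shift K ^ k) ↔ k < J.len b₀ := by
  rw [mem_range_shift_pow]
  refine ⟨fun h => ?_, fun hk b j hj => ?_⟩
  · by_contra hk
    exact one_ne_zero ((unitVec_apply_self (K := K) b₀).symm.trans (h b₀ 0 (by omega)))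
  · rcases eq_or_ne b b₀ with rfl | hb
    · obtain ⟨j, rfl⟩ := Nat.exists_eq_add_of_lt (show 0 < j by omega)
      rw [zero_add]
      exact shift_eq_zero_iff.mp (shift_unitVec b) b j
    · exact unitVec_apply_of_ne hb j

theorem unitVec_ne_zero [Nontrivial K] (b₀ : J.Index) : J.unitVec K b₀ ≠ 0 := fun h =>
  zero_ne_one ((congrArg (fun m : J.space K => m.1 b₀ 0) h).symm.trans (unitVec_apply_self b₀))

theorem shift_eq_zero_iff_forall_len [Nontrivial K] : J.shift K = 0 ↔ ∀ b, J.len b = 1 := by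
  refine ⟨fun h b => ?_, fun h => ?_⟩
  · by_contra hb
    have hmem : J.unitVec K b ∈ LinearMap.range (J.shift K ^ 1) :=
      unitVec_mem_range_shift_pow_iff.mpr (by have := J.one_le_len b; omega)
    rw [h, pow_one, LinearMap.range_zero, Submodule.mem_bot] at hmem
    exact unitVec_ne_zero b hmem
  · ext m b j
    rw [shift_apply]
    exact m.2 b (j + 1) (by rw [h]; omega)

variable (J K) in
/-- The first coordinates of a vector in the blocks of size `k + 1`. They identify the quotient of
consecutive socles `socle k / socle (k + 1)` of the shift. -/
def headCoord (k : ℕ) : J.space K →ₗ[K] {b // J.len b = k + 1} → K where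
  toFun m b := m.1 b 0
  map_add' _ _ := rfl
  map_smul' _ _ := rfl

theorem continuous_headCoord [TopologicalSpace K] (k : ℕ) : Continuous (J.headCoord K k) :=
  continuous_pi fun b => (continuous_apply_apply b.1 0).comp continuous_subtype_val

theorem exists_mem_socle_headCoord_eq {k : ℕ} (c : {b // J.len b = k + 1} → K) :
    ∃ m ∈ socle (J.shift K) k, J.headCoord K k m = c := by
  classical
  refine ⟨⟨fun b j => if h : J.len b = k + 1 ∧ j = 0 then c ⟨b, h.1⟩ else 0, ?_⟩, ⟨?_, ?_⟩, ?_⟩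
  · exact fun b j hj => dif_neg (by omega)
  · exact shift_eq_zero_iff.mpr fun b j => dif_neg (by omega)
  · exact mem_range_shift_pow.mpr fun b j hj => dif_neg (by omega)
  · exact funext fun b => dif_pos ⟨b.2, rfl⟩

theorem headCoord_eq_zero_iff {k : ℕ} {m : J.space K} (hm : m ∈ socle (J.shift K) k) :
    J.headCoord K k m = 0 ↔ m ∈ socle (J.shift K) (k + 1) := by
  have hrange := mem_range_shift_pow.mp hm.2
  refine ⟨fun h => ⟨hm.1, mem_range_shift_pow.mpr fun b j hj => ?_⟩, fun h => funext fun b => ?_⟩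
  · rcases j with - | j
    · by_cases hb : J.len b = k + 1
      · exact congrFun h ⟨b, hb⟩
      · exact hrange b 0 (by omega)
    · exact shift_eq_zero_iff.mp hm.1 b j
  · exact mem_range_shift_pow.mp h.2 b 0 (by rw [b.2]; omega)

end JordanType

namespace Presentation

section Degenerate

variable {p : ℕ} [Fact p.Prime] {M : Type v} [AddCommGroup M] [Module (ZMod p) M]
  [TopologicalSpace M] {D : CyclicDatum p M} {T : Type v} [Group T] [TopologicalSpace T]
  (P : Presentation D T)

theorem param_mk_add (hD : D.IsTrivial) (m n : M) (a b : ZMod p) :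
    P.param (.mk D (m + n) (a + b)) = P.param (.mk D m a) * P.param (.mk D n b) := by
  rw [← P.param.map_mul, CyclicDatum.Extension.mk_mul_mk, hD.1, hD.2, add_zero, one_pow, smul_zero,
    add_zero, Module.End.one_apply]

include P in
theorem centerTorsion_eq_top (hD : D.IsTrivial) : centerTorsion p T = ⊤ := by
  refine (Subgroup.eq_top_iff' _).mpr fun t => ⟨Subgroup.mem_center_iff.mpr fun s => ?_, ?_⟩
  · obtain ⟨⟨m, a⟩, rfl⟩ := P.bijective_param.2 t
    obtain ⟨⟨n, b⟩, rfl⟩ := P.bijective_param.2 s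
    have h := P.param_mk_add hD m n a b
    rw [add_comm m, add_comm a, P.param_mk_add hD] at h
    exact h
  · obtain ⟨m, a, rfl⟩ := P.exists_eq t
    obtain ⟨n, hn, hpow⟩ := P.exists_pow_prime_eq m a
    rw [hD.1, zero_pow (Nat.sub_ne_zero_of_lt (Fact.out : p.Prime).one_lt),
      LinearMap.range_zero, Submodule.mem_bot] at hn
    rw [hpow, hn, hD.2, smul_zero, add_zero, P.map_zero]

end Degenerate

section Invariants

variable {p : ℕ} [Fact p.Prime] {J : JordanType.{v} p} {z : J.space (ZMod p)}
  {hz : J.shift (ZMod p) z = 0} {T : Type v} [Group T] [TopologicalSpace T] [T2Space T]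

theorem dimH1_eq_mult (P : Presentation (J.datum hz) T) (k : ℕ) {A K : Subgroup T}
    (hA : A = P.image (socle (J.shift (ZMod p)) k))
    (hK : Subgroup.center T ⊓ K = P.image (socle (J.shift (ZMod p)) (k + 1))) :
    dimH1 p T A K = J.mult (k + 1) := by
  refine P.dimH1_eq_of_image ?_ hA hK
    ((J.headCoord (ZMod p) k).toAddMonoidHom.comp (Submodule.subtype _).toAddMonoidHom)
    ((JordanType.continuous_headCoord k).comp continuous_subtype_val) (fun c => ?_)
    fun s => JordanType.headCoord_eq_zero_iff s.2
  · exact (isClosed_eq JordanType.continuous_shift continuous_const).inter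
      (isClosed_range_pow JordanType.continuous_shift k)
  · obtain ⟨m, hm, rfl⟩ := JordanType.exists_mem_socle_headCoord_eq c
    exact ⟨⟨m, hm⟩, rfl⟩

variable [IsTopologicalGroup T]

theorem tInv_eq_mult (P : Presentation (J.datum hz) T) {i : ℕ} (hi : 2 ≤ i) :
    tInv p T i = J.mult i := by
  obtain ⟨k, rfl⟩ := Nat.exists_eq_add_of_le' hi
  rw [tInv, if_neg (by omega)]
  exact P.dimH1_eq_mult (k + 1) (P.center_inf_centralSeries k) (P.center_inf_centralSeries (k + 1))

theorem tInv_one_eq_mult (P : Presentation (J.datum hz) T) (hD : ¬(J.datum hz).IsTrivial) :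
    tInv p T 1 = J.mult 1 := by
  have hsocle : socle (J.shift (ZMod p)) 0 = LinearMap.ker (J.shift (ZMod p)) := by
    rw [socle, pow_zero, Module.End.one_eq_id, LinearMap.range_id, inf_top_eq]
  rw [tInv, if_pos rfl]
  refine P.dimH1_eq_mult 0 ?_ (P.center_inf_centralSeries 0)
  rw [hsocle]
  exact P.centerTorsion_eq hD

theorem tInv_eq_mult_of_one_le (P : Presentation (J.datum hz) T) (hD : ¬(J.datum hz).IsTrivial)
    {i : ℕ} (hi : 1 ≤ i) : tInv p T i = J.mult i :=
  hi.eq_or_lt.elim (fun h => h ▸ P.tInv_one_eq_mult hD) P.tInv_eq_mult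

theorem tInv_one_eq_mult_add_one (P : Presentation (J.datum hz) T)
    (hD : (J.datum hz).IsTrivial) : tInv p T 1 = J.mult 1 + 1 := by
  have hmem : ∀ m : J.space (ZMod p), m ∈ socle (J.shift (ZMod p)) 0 := fun m =>
    ⟨LinearMap.congr_fun hD.1 m, m, rfl⟩
  let π : J.space (ZMod p) × ZMod p →+ Option {b // J.len b = 0 + 1} → ZMod p :=
    AddMonoidHom.mk' (fun x o => o.elim x.2 (J.headCoord (ZMod p) 0 x.1)) fun _ _ =>
      funext fun o => o.rec rfl fun _ => rfl
  have hπ : Continuous π := continuous_pi fun o => o.rec continuous_snd fun b =>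
    (continuous_apply b).comp ((JordanType.continuous_headCoord 0).comp continuous_fst)
  have hsurj : Function.Surjective π := fun c => by
    obtain ⟨m, -, hm⟩ := JordanType.exists_mem_socle_headCoord_eq (J := J) fun b => c (some b)
    exact ⟨(m, c none), funext fun o => o.rec rfl fun b => congrFun hm b⟩
  have hπ_eq_zero : ∀ x, π x = 0 ↔ J.headCoord (ZMod p) 0 x.1 = 0 ∧ x.2 = 0 := fun x =>
    ⟨fun h => ⟨funext fun b => congrFun h (some b), congrFun h none⟩,
      fun h => funext fun o => o.rec h.2 fun b => congrFun h.1 b⟩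
  rw [tInv, if_pos rfl, JordanType.mult, ← Cardinal.mk_option]
  have hparam : Continuous fun x : J.space (ZMod p) × ZMod p => P.param (.mk _ x.1 x.2) :=
    P.continuous_param
  refine dimH1_eq hparam (fun x y => P.param_mk_add hD x.1 y.1 x.2 y.2) ?_ hπ hsurj fun x => ?_
  · rw [P.centerTorsion_eq_top hD, Subgroup.coe_top]
    exact P.bijective_param.2.range_eq
  · rw [P.center_inf_centralSeries 0, P.param_mk_mem_image, hπ_eq_zero,
      JordanType.headCoord_eq_zero_iff (hmem x.1)]
    rfl

theorem uInv_eq_prime (P : Presentation J.splitDatum T) : uInv p T = p := by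
  have hp := (Fact.out : p.Prime).two_le
  refine IsGreatest.csSup_eq ⟨⟨by omega, le_rfl, ?_⟩, fun i hi => hi.2.1⟩
  obtain ⟨k, hk⟩ := Nat.exists_eq_add_of_le' hp
  have h := (P.powerSubgroup_le_iff (k := k) (by omega)).mpr (Submodule.zero_mem _)
  rwa [← hk] at h

theorem uInv_eq_len {b₀ : J.Index} (P : Presentation (J.nonsplitDatum b₀) T) :
    uInv p T = J.len b₀ := by
  have hle : ∀ i, 1 ≤ i → i ≤ p → (powerSubgroup p T ≤ centralSeries T i ↔ i ≤ J.len b₀) := by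
    rintro (_ | _ | k) hi hip
    · omega
    · exact iff_of_true le_top (J.one_le_len b₀)
    · exact (P.powerSubgroup_le_iff hip).trans JordanType.unitVec_mem_range_shift_pow_iff
  have hb₀ := J.one_le_len b₀
  exact IsGreatest.csSup_eq ⟨⟨hb₀, J.len_le b₀, (hle _ hb₀ (J.len_le b₀)).mpr le_rfl⟩,
    fun i hi => (hle i hi.1 hi.2.1).mp hi.2.2⟩

end Invariants

end Presentation

namespace JordanType

section Reindex

variable {n : ℕ} {J J' : JordanType.{v} n}

theorem exists_equiv_of_mult_eq (h : ∀ i, 1 ≤ i → i ≤ n → J.mult i = J'.mult i) :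
    ∃ ε : J.Index ≃ J'.Index, ∀ b, J'.len (ε b) = J.len b := by
  have hfiber : ∀ i, Nonempty ({b // J.len b = i} ≃ {b // J'.len b = i}) := fun i => by
    by_cases hi : 1 ≤ i ∧ i ≤ n
    · exact Cardinal.eq.mp (h i hi.1 hi.2)
    · have : IsEmpty {b // J.len b = i} := ⟨fun b => hi (b.2 ▸ ⟨J.one_le_len _, J.len_le _⟩)⟩
      have : IsEmpty {b // J'.len b = i} := ⟨fun b => hi (b.2 ▸ ⟨J'.one_le_len _, J'.len_le _⟩)⟩
      exact ⟨Equiv.equivOfIsEmpty _ _⟩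
  let e := fun i => (hfiber i).some
  exact ⟨((Equiv.sigmaFiberEquiv J.len).symm.trans (Equiv.sigmaCongrRight e)).trans
    (Equiv.sigmaFiberEquiv J'.len), fun b => (e (J.len b) ⟨b, rfl⟩).2⟩

theorem exists_equiv_apply_eq_of_mult_eq (h : ∀ i, 1 ≤ i → i ≤ n → J.mult i = J'.mult i)
    {b₀ : J.Index} {b₀' : J'.Index} (hb₀ : J.len b₀ = J'.len b₀') :
    ∃ ε : J.Index ≃ J'.Index, (∀ b, J'.len (ε b) = J.len b) ∧ ε b₀ = b₀' := by
  classical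
  obtain ⟨ε, hε⟩ := exists_equiv_of_mult_eq h
  refine ⟨ε.trans (Equiv.swap (ε b₀) b₀'), fun b => ?_, Equiv.swap_apply_left _ _⟩
  rw [← hε b, Equiv.trans_apply]
  exact Equiv.apply_swap_eq_self ((hε b₀).trans hb₀) _

variable {K : Type*} [Semiring K]

variable (K) in
/-- Relabelling of the blocks. -/
def reindex (ε : J.Index ≃ J'.Index) (hε : ∀ b, J'.len (ε b) = J.len b) :
    J.space K ≃ₗ[K] J'.space K where
  toFun m := ⟨fun b j => m.1 (ε.symm b) j, fun b j hj => m.2 _ _ (by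
    rwa [← hε, ε.apply_symm_apply])⟩
  invFun m := ⟨fun b j => m.1 (ε b) j, fun b j hj => m.2 _ _ (by rwa [hε])⟩
  map_add' _ _ := rfl
  map_smul' _ _ := rfl
  left_inv m := by
    ext b j
    exact congrArg (fun b => m.1 b j) (ε.symm_apply_apply b)
  right_inv m := by
    ext b j
    exact congrArg (fun b => m.1 b j) (ε.apply_symm_apply b)

variable (ε : J.Index ≃ J'.Index) (hε : ∀ b, J'.len (ε b) = J.len b)

theorem reindex_apply (m : J.space K) (b : J'.Index) (j : ℕ) :
    (reindex K ε hε m).1 b j = m.1 (ε.symm b) j :=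
  rfl

theorem shift_reindex (m : J.space K) :
    J'.shift K (reindex K ε hε m) = reindex K ε hε (J.shift K m) :=
  rfl

theorem reindex_unitVec (b₀ : J.Index) :
    reindex K ε hε (J.unitVec K b₀) = J'.unitVec K (ε b₀) := by
  refine eq_of_shift_eq_zero (by rw [shift_reindex, shift_unitVec, map_zero]) (shift_unitVec _)
    fun b => ?_
  rw [reindex_apply]
  rcases eq_or_ne b (ε b₀) with rfl | hb
  · rw [ε.symm_apply_apply, unitVec_apply_self, unitVec_apply_self]
  · rw [unitVec_apply_of_ne hb, unitVec_apply_of_ne (mt ε.symm_apply_eq.mp hb)]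

theorem continuous_reindex [TopologicalSpace K] : Continuous (reindex K ε hε) := by
  refine Continuous.subtype_mk (continuous_pi fun b => continuous_pi fun j => ?_) _
  exact (continuous_apply_apply (ε.symm b) j).comp continuous_subtype_val

end Reindex

section OfMult

/-- The Jordan type with prescribed multiplicities `t i` for `1 ≤ i ≤ n`. -/
noncomputable def ofMult (n : ℕ) (t : ℕ → Cardinal.{v}) : JordanType.{v} n where
  Index := Σ i : Fin n, (t (i + 1)).out
  len b := b.1 + 1
  one_le_len _ := Nat.le_add_left 1 _
  len_le b := b.1.2

theorem mult_ofMult {n : ℕ} (t : ℕ → Cardinal.{v}) {i : ℕ} (hi : 1 ≤ i) (hin : i ≤ n) :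
    (ofMult n t).mult i = t i := by
  obtain ⟨k, rfl⟩ := Nat.exists_eq_add_of_le' hi
  have e : {b : (ofMult n t).Index // (ofMult n t).len b = k + 1} ≃ (t (k + 1)).out :=
    (Equiv.subtypeEquivRight fun b => Nat.succ_inj.trans (Fin.ext_iff (b := ⟨k, hin⟩)).symm).trans
      (Equiv.sigmaSubtype (β := fun i : Fin n => (t (i + 1)).out) ⟨k, hin⟩)
  rw [mult, Cardinal.mk_congr e, Cardinal.mk_out]

end OfMult

variable {p : ℕ} [Fact p.Prime] {J : JordanType.{v} p}

theorem isTrivial_splitDatum_iff :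
    J.splitDatum.IsTrivial ↔ ∀ i, 2 ≤ i → i ≤ p → J.mult i = 0 := by
  rw [← forall_len_eq_one_iff, ← shift_eq_zero_iff_forall_len (K := ZMod p)]
  exact and_iff_left rfl

theorem not_isTrivial_nonsplitDatum (b₀ : J.Index) : ¬(J.nonsplitDatum b₀).IsTrivial := fun h =>
  unitVec_ne_zero b₀ h.2

end JordanType

section Uniqueness

variable {p : ℕ} [Fact p.Prime] {J J' : JordanType.{v} p} {T T' : Type v} [Group T]
  [TopologicalSpace T] [IsTopologicalGroup T] [T2Space T] [Group T'] [TopologicalSpace T']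
  [IsTopologicalGroup T'] [T2Space T']

theorem nonempty_continuousMulEquiv_of_splitDatum (P : Presentation J.splitDatum T)
    (P' : Presentation J'.splitDatum T')
    (ht : ∀ i, 1 ≤ i → i ≤ p → tInv p T i = tInv p T' i) : Nonempty (T ≃ₜ* T') := by
  have hmult : ∀ i, 2 ≤ i → i ≤ p → J.mult i = J'.mult i := fun i hi hip => by
    rw [← P.tInv_eq_mult hi, ← P'.tInv_eq_mult hi, ht i (by omega) hip]
  have htrivial : J.splitDatum.IsTrivial ↔ J'.splitDatum.IsTrivial := by
    simp only [JordanType.isTrivial_splitDatum_iff]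
    exact forall₃_congr fun i hi hip => by rw [hmult i hi hip]
  have hmult_one : J.mult 1 = J'.mult 1 := by
    have ht_one := ht 1 le_rfl (Fact.out : p.Prime).one_le
    by_cases hD : J.splitDatum.IsTrivial
    · rw [P.tInv_one_eq_mult_add_one hD, P'.tInv_one_eq_mult_add_one (htrivial.mp hD)] at ht_one
      exact Cardinal.add_one_inj.mp ht_one
    · rwa [P.tInv_one_eq_mult hD, P'.tInv_one_eq_mult (mt htrivial.mpr hD)] at ht_one
  obtain ⟨ε, hε⟩ := JordanType.exists_equiv_of_mult_eq fun i hi hip =>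
    hi.eq_or_lt.elim (fun h => h ▸ hmult_one) fun h => hmult i h hip
  exact P.nonempty_continuousMulEquiv (P'.comp (D' := J.splitDatum)
    (JordanType.reindex _ ε hε) (JordanType.continuous_reindex ε hε)
    (JordanType.shift_reindex ε hε) (map_zero _))

theorem nonempty_continuousMulEquiv_of_nonsplitDatum {b₀ : J.Index} {b₀' : J'.Index}
    (P : Presentation (J.nonsplitDatum b₀) T) (P' : Presentation (J'.nonsplitDatum b₀') T')
    (ht : ∀ i, 1 ≤ i → i ≤ p → tInv p T i = tInv p T' i) (hu : uInv p T = uInv p T') :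
    Nonempty (T ≃ₜ* T') := by
  rw [P.uInv_eq_len, P'.uInv_eq_len] at hu
  obtain ⟨ε, hε, rfl⟩ := JordanType.exists_equiv_apply_eq_of_mult_eq (fun i hi hip => by
    rw [← P.tInv_eq_mult_of_one_le (JordanType.not_isTrivial_nonsplitDatum b₀) hi,
      ← P'.tInv_eq_mult_of_one_le (JordanType.not_isTrivial_nonsplitDatum b₀') hi, ht i hi hip]) hu
  exact P.nonempty_continuousMulEquiv (P'.comp (D' := J.nonsplitDatum b₀)
    (JordanType.reindex _ ε hε) (JordanType.continuous_reindex ε hε)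
    (JordanType.shift_reindex ε hε) (JordanType.reindex_unitVec ε hε b₀))

end Uniqueness

section Classification

variable {p : ℕ} [Fact p.Prime] {T T' : ProfiniteGrp.{v}}

theorem IsTGroup.nonempty_continuousMulEquiv (hT : IsTGroup p T) (hT' : IsTGroup p T')
    (ht : ∀ i, 1 ≤ i → i ≤ p → tInv p T i = tInv p T' i) (hu : uInv p T = uInv p T') :
    Nonempty (T ≃ₜ* T') := by
  obtain ⟨J, ⟨⟨P⟩⟩ | ⟨b₀, hb₀, ⟨P⟩⟩⟩ := exists_jordan_presentation_of_isTGroup hT <;>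
    obtain ⟨J', ⟨⟨P'⟩⟩ | ⟨b₀', hb₀', ⟨P'⟩⟩⟩ := exists_jordan_presentation_of_isTGroup hT'
  · exact nonempty_continuousMulEquiv_of_splitDatum P P' ht
  · rw [P.uInv_eq_prime, P'.uInv_eq_len] at hu
    exact absurd hu hb₀'.ne'
  · rw [P.uInv_eq_len, P'.uInv_eq_prime] at hu
    exact absurd hu hb₀.ne
  · exact nonempty_continuousMulEquiv_of_nonsplitDatum P P' ht hu

theorem IsTGroup.one_le_tInv_uInv (hT : IsTGroup p T) (hu : uInv p T < p) :
    1 ≤ tInv p T (uInv p T) := by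
  obtain ⟨J, ⟨⟨P⟩⟩ | ⟨b₀, -, ⟨P⟩⟩⟩ := exists_jordan_presentation_of_isTGroup hT
  · exact absurd P.uInv_eq_prime hu.ne
  · rw [P.uInv_eq_len, P.tInv_eq_mult_of_one_le (JordanType.not_isTrivial_nonsplitDatum b₀)
      (J.one_le_len b₀)]
    exact JordanType.one_le_mult_len b₀

theorem IsTGroup.one_le_tInv_one (hT : IsTGroup p T)
    (h : ∀ i, 2 ≤ i → i ≤ p → tInv p T i = 0) : 1 ≤ tInv p T 1 := by
  obtain ⟨J, ⟨⟨P⟩⟩ | ⟨b₀, -, ⟨P⟩⟩⟩ := exists_jordan_presentation_of_isTGroup hT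
  · have hD := JordanType.isTrivial_splitDatum_iff.mpr fun i hi hip =>
      (P.tInv_eq_mult hi).symm.trans (h i hi hip)
    rw [P.tInv_one_eq_mult_add_one hD]
    exact le_add_self
  · have hlen := JordanType.forall_len_eq_one_iff.mpr fun i hi hip =>
      (P.tInv_eq_mult hi).symm.trans (h i hi hip)
    rw [P.tInv_one_eq_mult (JordanType.not_isTrivial_nonsplitDatum b₀), ← hlen b₀]
    exact JordanType.one_le_mult_len b₀

theorem exists_isTGroup_presentation {M : Type v} [AddCommGroup M] [Module (ZMod p) M]
    [TopologicalSpace M] [IsTopologicalAddGroup M] [CompactSpace M] [TotallyDisconnectedSpace M]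
    (D : CyclicDatum p M) :
    ∃ T : ProfiniteGrp.{v}, IsTGroup p T ∧ Nonempty (Presentation D T) :=
  have P : Presentation D (ProfiniteGrp.of D.Extension) := CyclicDatum.Extension.presentation D
  ⟨_, P.isTGroup, ⟨P⟩⟩

variable {t : ℕ → Cardinal.{v}}

theorem exists_isTGroup_of_lt {u : ℕ} (hu : 1 ≤ u) (hup : u < p) (h : 1 ≤ t u) :
    ∃ T : ProfiniteGrp.{v}, IsTGroup p T ∧ (∀ i, 1 ≤ i → i ≤ p → tInv p T i = t i) ∧
      uInv p T = u := by
  have hmult : ∀ i, 1 ≤ i → i ≤ p → (JordanType.ofMult p t).mult i = t i :=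
    fun i => JordanType.mult_ofMult t
  obtain ⟨b₀, hb₀⟩ : ∃ b, (JordanType.ofMult p t).len b = u := by
    by_contra! hne
    rw [← hmult u hu hup.le, JordanType.mult_eq_zero_iff.mpr hne] at h
    exact h.not_gt zero_lt_one
  obtain ⟨T, hT, ⟨P⟩⟩ := exists_isTGroup_presentation ((JordanType.ofMult p t).nonsplitDatum b₀)
  refine ⟨T, hT, fun i hi hip => ?_, P.uInv_eq_len.trans hb₀⟩
  rw [P.tInv_eq_mult_of_one_le (JordanType.not_isTrivial_nonsplitDatum b₀) hi, hmult i hi hip]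

theorem exists_isTGroup_of_exists_ne_zero (h : ∃ i, 2 ≤ i ∧ i ≤ p ∧ t i ≠ 0) :
    ∃ T : ProfiniteGrp.{v}, IsTGroup p T ∧ (∀ i, 1 ≤ i → i ≤ p → tInv p T i = t i) ∧
      uInv p T = p := by
  have hmult : ∀ i, 1 ≤ i → i ≤ p → (JordanType.ofMult p t).mult i = t i :=
    fun i => JordanType.mult_ofMult t
  have hD : ¬(JordanType.ofMult p t).splitDatum.IsTrivial := fun hD => by
    obtain ⟨i, hi, hip, hne⟩ := h
    exact hne ((hmult i (by omega) hip).symm.trans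
      (JordanType.isTrivial_splitDatum_iff.mp hD i hi hip))
  obtain ⟨T, hT, ⟨P⟩⟩ := exists_isTGroup_presentation (JordanType.ofMult p t).splitDatum
  refine ⟨T, hT, fun i hi hip => ?_, P.uInv_eq_prime⟩
  rw [P.tInv_eq_mult_of_one_le hD hi, hmult i hi hip]

theorem exists_isTGroup_of_forall_eq_zero (h : ∀ i, 2 ≤ i → i ≤ p → t i = 0) (h_one : 1 ≤ t 1) :
    ∃ T : ProfiniteGrp.{v}, IsTGroup p T ∧ (∀ i, 1 ≤ i → i ≤ p → tInv p T i = t i) ∧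
      uInv p T = p := by
  obtain ⟨c, hc⟩ := exists_add_of_le h_one
  let J := JordanType.ofMult p (Function.update t 1 c)
  have hmult_one : J.mult 1 = c := by
    rw [JordanType.mult_ofMult _ le_rfl (Fact.out : p.Prime).one_le, Function.update_self]
  have hmult : ∀ i, 2 ≤ i → i ≤ p → J.mult i = t i := fun i hi hip => by
    rw [JordanType.mult_ofMult _ (by omega) hip, Function.update_of_ne (by omega)]
  have hD : J.splitDatum.IsTrivial := JordanType.isTrivial_splitDatum_iff.mpr fun i hi hip =>
    (hmult i hi hip).trans (h i hi hip)
  obtain ⟨T, hT, ⟨P⟩⟩ := exists_isTGroup_presentation J.splitDatum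
  refine ⟨T, hT, fun i hi hip => ?_, P.uInv_eq_prime⟩
  rcases hi.eq_or_lt with rfl | hi
  · rw [P.tInv_one_eq_mult_add_one hD, hmult_one, hc, add_comm]
  · rw [P.tInv_eq_mult hi, hmult i hi hip]

end Classification

end TGroups

theorem mainTheorem4 (p : ℕ) [Fact p.Prime] :
    (∀ (t : ℕ → Cardinal.{v}) (u : ℕ), 1 ≤ u → u ≤ p →
      ((∃ T : ProfiniteGrp.{v}, TGroups.IsTGroup p T ∧
          (∀ i, 1 ≤ i → i ≤ p → TGroups.tInv p T i = t i) ∧ TGroups.uInv p T = u) ↔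
        ((u < p → 1 ≤ t u) ∧
          (u = p → (∀ i, 2 ≤ i → i ≤ p → t i = 0) → 1 ≤ t 1)))) ∧
    (∀ T T' : ProfiniteGrp.{v}, TGroups.IsTGroup p T → TGroups.IsTGroup p T' →
      (∀ i, 1 ≤ i → i ≤ p → TGroups.tInv p T i = TGroups.tInv p T' i) →
      TGroups.uInv p T = TGroups.uInv p T' → Nonempty (T ≃ₜ* T')) := by
  refine ⟨fun t u hu hup => ⟨?_, ?_⟩, fun T T' hT hT' => hT.nonempty_continuousMulEquiv hT'⟩
  · rintro ⟨T, hT, ht, rfl⟩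
    refine ⟨fun h => ht _ hu hup ▸ hT.one_le_tInv_uInv h, fun _ h => ?_⟩
    rw [← ht 1 le_rfl (hu.trans hup)]
    exact hT.one_le_tInv_one fun i hi hip => (ht i (by omega) hip).trans (h i hi hip)
  · rintro ⟨hlt, heq⟩
    rcases hup.lt_or_eq with hup | rfl
    · exact TGroups.exists_isTGroup_of_lt hu hup (hlt hup)
    · by_cases h : ∀ i, 2 ≤ i → i ≤ u → t i = 0
      · exact TGroups.exists_isTGroup_of_forall_eq_zero h (heq rfl h)
      · push Not at h
        exact TGroups.exists_isTGroup_of_exists_ne_zero h
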